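/- Let $m>n\ge 3$ and $N>0$ be integers, let $\mu\ge 1$ be real, let $\delta\in(1/4,1)$, $c=(\delta-1/4)^{-1}$ and $\varepsilon\in(0,1)$, and assume $$\log(N\varepsilon) > \frac{mn}{2}\log c + n(n+1)\log\mu + \frac{n(m-n)}{2}\log\Big(\frac23(m-n)\Big) + n\log(3\sqrt n) + 1 .$$ Let $\mathfrak B=\{v_1,\dots,v_n\}\subset\mathbb Z^m$ be any collection of $n$ vectors whose reductions modulo $N$ are linearly independent over $\mathbb Z/N\mathbb Z$ and such that $\big(\frac1n\sum_i\|v_i\|^2\big)^{1/2}\le\mu$ (Euclidean norm). Let $\mathcal L=\bigoplus_i\mathbb Z v_i$, let $\overline{\mathcal L}=\mathcal L_{\mathbb Q}\cap\mathbb Z^m$ be its completion and let $\mathcal L^\perp=\{u\in\mathbb Z^m : \langle u,w\rangle=0 \text{ for all } w\in\mathcal L\}$. For $a\in(\mathbb Z/N\mathbb Z)^n$ put $F_{\mathfrak B}(a)=\sum_i a_i\,(v_i \bmod N)\in(\mathbb Z/N\mathbb Z)^m$, let $$(\mathbb Z F_{\mathfrak B}(a))^{\perp_N}=\{u\in\mathbb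 Z^m : \langle u,w\rangle\equiv 0 \!\!\pmod N \text{ for all } w\in\mathbb Z^m \text{ with } (w \bmod N)\in\mathbb Z F_{\mathfrak B}(a)\},$$ and let $\mathcal H(\mathfrak B)=\{F_{\mathfrak B}(a) : a\in(\mathbb Z/N\mathbb Z)^n\}$. Given $x\in\mathcal H(\mathfrak B)$, $n$ and $N$, Algorithm I with $\delta$-LLL does the following: it computes a $\delta$-LLL-reduced basis $u_1,\dots,u_m$ of $(\mathbb Z x)^{\perp_N}$ (that is, a size-reduced basis that satisfies the Lovász condition with parameter $\delta$), orders it by increasing norm, forms the lattice $\mathcal N$ generated by the first $m-n$ vectors, and returns a basis of $\mathcal N^\perp$. It solves $x$ if it returns a basis of $\overline{\mathcal L}$, whichever reduced basis, ordering of vectors of equal norm and basis of $\mathcal N^\perp$ are used. Then $\#\mathcal H(\mathfrak B)=N^n$, and at least $(1-\varepsilon)N^n$ of the elements of $\mathcal H(\mathfrak B)$ are solved by Algorithm I with $\delta$-LLL. More precisely, for at least $(1-\varepsilon)N^n$ elements $x$ of $\mathcal H(\mathfrak B)$, Algorithm I solves $x$ and, for every $\delta$-LLL-reduced basis $u_1,\dots,u_m$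 of $(\mathbb Z x)^{\perp_N}$, the first $m-n$ vectors lie in $\mathcal L^\perp$, both in the order of the reduced basis and after ordering by increasing norm. -/

import Mathlib

namespace HiddenLattice

/-- Lattices in `ℤ^m` are subgroups of `ℤ^m`. -/
abbrev Lat (m : ℕ) := Submodule ℤ (Fin m → ℤ)

/-- An integral vector as a vector of Euclidean space. -/
noncomputable def toEuclidean {m : ℕ} (v : Fin m → ℤ) : EuclideanSpace ℝ (Fin m) :=
  WithLp.toLp 2 (fun i => (v i : ℝ))

/-- The inclusion of `ℤ^m` in `ℚ^m`. -/
def toRat (m : ℕ) : (Fin m → ℤ) →ₗ[ℤ] (Fin m → ℚ) :=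
  (Int.castAddHom ℚ).toIntLinearMap.compLeft (Fin m)

/-- Reduction modulo `N`, the map `π_N : ℤ^m → (ℤ/Nℤ)^m`. -/
def reduce (N m : ℕ) : (Fin m → ℤ) →ₗ[ℤ] (Fin m → ZMod N) :=
  (Int.castAddHom (ZMod N)).toIntLinearMap.compLeft (Fin m)

/-- `b` is a `ℤ`-basis of the lattice `Λ`. -/
def IsLatticeBasis {k m : ℕ} (Λ : Lat m) (b : Fin k → Fin m → ℤ) : Prop :=
  LinearIndependent ℤ b ∧ Submodule.span ℤ (Set.range b) = Λ

/-- The completion `Λ_ℚ ∩ ℤ^m` of `Λ`. -/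
def completion {m : ℕ} (Λ : Lat m) : Lat m :=
  ((Submodule.span ℚ (toRat m '' (Λ : Set (Fin m → ℤ)))).restrictScalars ℤ).comap (toRat m)

/-- The orthogonal lattice `Λ^⊥` in `ℤ^m`. -/
def orth {m : ℕ} (Λ : Lat m) : Lat m where
  carrier := {v | ∀ w ∈ Λ, v ⬝ᵥ w = 0}
  zero_mem' := fun w _ => zero_dotProduct w
  add_mem' := fun {u v} hu hv w hw => by rw [add_dotProduct, hu w hw, hv w hw, add_zero]
  smul_mem' := fun c v hv w hw => by rw [smul_dotProduct, hv w hw, smul_zero]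

/-- The `N`-orthogonal lattice of a subgroup `M` of `(ℤ/Nℤ)^m`: the integral vectors `v` with
`⟨v, w⟩ ≡ 0 (mod N)` for all integral vectors `w` whose reduction modulo `N` lies in `M`. -/
def orthMod {N m : ℕ} (M : Submodule ℤ (Fin m → ZMod N)) : Lat m where
  carrier := {v | ∀ w : Fin m → ℤ, reduce N m w ∈ M → (N : ℤ) ∣ v ⬝ᵥ w}
  zero_mem' := fun w _ => by rw [zero_dotProduct]; exact dvd_zero _
  add_mem' := fun {u v} hu hv w hw => by
    rw [add_dotProduct]; exact dvd_add (hu w hw) (hv w hw)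
  smul_mem' := fun c v hv w hw => by
    rw [smul_dotProduct, smul_eq_mul]; exact Dvd.dvd.mul_left (hv w hw) c

/-- The size `σ(𝔅) = √((1/n) ∑ ‖v_i‖²)` of a collection of `n` integral vectors. -/
noncomputable def size {n m : ℕ} (B : Fin n → Fin m → ℤ) : ℝ :=
  Real.sqrt ((1 / (n : ℝ)) * ∑ i, ‖toEuclidean (B i)‖ ^ 2)

/-- The Gram–Schmidt vector `b_i^*`. -/
noncomputable def gsVec {k m : ℕ} (b : Fin k → Fin m → ℤ) (i : Fin k) :
    EuclideanSpace ℝ (Fin m) :=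
  InnerProductSpace.gramSchmidt ℝ (fun j => toEuclidean (b j)) i

/-- The Gram–Schmidt coefficient `⟨b_i, b_j^*⟩ / ‖b_j^*‖²`. -/
noncomputable def gsCoeff {k m : ℕ} (b : Fin k → Fin m → ℤ) (i j : Fin k) : ℝ :=
  inner ℝ (toEuclidean (b i)) (gsVec b j) / ‖gsVec b j‖ ^ 2

/-- `b` is a `δ`-LLL-reduced basis of `Λ`: it is size-reduced and satisfies the Lovász
condition with parameter `δ`. -/
structure IsLLLReducedBasis {k m : ℕ} (δ : ℝ) (Λ : Lat m) (b : Fin k → Fin m → ℤ) : Prop where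
  isBasis : IsLatticeBasis Λ b
  sizeReduced : ∀ i j : Fin k, j < i → |gsCoeff b i j| ≤ 1 / 2
  lovasz : ∀ i j : Fin k, (j : ℕ) = (i : ℕ) + 1 →
    δ * ‖gsVec b i‖ ^ 2 ≤ ‖gsVec b j + gsCoeff b j i • gsVec b i‖ ^ 2

/-- `τ` lists the vectors `u_i` by increasing norm. -/
def OrdersByNorm {k m : ℕ} (u : Fin k → Fin m → ℤ) (τ : Equiv.Perm (Fin k)) : Prop :=
  Monotone (fun i => ‖toEuclidean (u (τ i))‖)

/-- The lattice generated by the first `m - n` vectors of a family of `m` vectors. -/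
def spanFirst (n : ℕ) {m : ℕ} (u : Fin m → Fin m → ℤ) : Lat m :=
  Submodule.span ℤ (u '' {i | (i : ℕ) < m - n})

/-- `w` is a possible output of the orthogonal lattice algorithm (Algorithm I) with `δ`-LLL, on
input `n`, `N > 0` and the subgroup `M` of `(ℤ/Nℤ)^m`: a `δ`-LLL-reduced basis `u` of the
`N`-orthogonal lattice of `M` is computed and ordered by increasing norm; then a basis `w` of the
orthogonal lattice of the span of the first `m - n` vectors is returned. Nothing is
assumed on the choice of the reduced basis, on how ties in the ordering are broken, or on the
choice of the returned basis. -/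
def IsOutputAlgorithmI {N m : ℕ} (n : ℕ) (δ : ℝ) (M : Submodule ℤ (Fin m → ZMod N))
    (w : Fin n → Fin m → ℤ) : Prop :=
  ∃ (u : Fin m → Fin m → ℤ) (τ : Equiv.Perm (Fin m)),
    IsLLLReducedBasis δ (orthMod M) u ∧ OrdersByNorm u τ ∧
      IsLatticeBasis (orth (spanFirst n (fun i => u (τ i)))) w

/-- The set `Ω` of collections of `n` vectors of `ℤ^m` that are linearly independent modulo `N`
and have size at most `μ`. -/
def Omega (n m N : ℕ) (μ : ℝ) : Set (Fin n → Fin m → ℤ) :=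
  {B | LinearIndependent (ZMod N) (fun i => reduce N m (B i)) ∧ size B ≤ μ}

/-- The hidden lattice `ℒ(𝔅)` generated by `𝔅`. -/
def hiddenLattice {n m : ℕ} (B : Fin n → Fin m → ℤ) : Lat m :=
  Submodule.span ℤ (Set.range B)

/-- The map `F_𝔅 : (ℤ/Nℤ)^n → (ℤ/Nℤ)^m`, `a ↦ ∑ a_i π_N(v_i)`. -/
def F {n m : ℕ} (N : ℕ) (B : Fin n → Fin m → ℤ) (a : Fin n → ZMod N) : Fin m → ZMod N :=
  ∑ i, a i • reduce N m (B i)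

/-- The sample space `ℋ(𝔅)` of hidden lattice problems `F_𝔅(a)`. -/
def problems {n m : ℕ} (N : ℕ) (B : Fin n → Fin m → ℤ) : Set (Fin m → ZMod N) :=
  Set.range (F N B)

/-- The public subgroup `ℤ x` of `(ℤ/Nℤ)^m` of the problem `x`. -/
def publicLattice {N m : ℕ} (x : Fin m → ZMod N) : Submodule ℤ (Fin m → ZMod N) :=
  Submodule.span ℤ {x}

/-- The subset `ℋ_{δ,I}(𝔅)` of the problems for which Algorithm I with `δ`-LLL succeeds: it has
an output, and every output is a basis of the completion of the hidden lattice. -/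
def solvedI {n m : ℕ} (N : ℕ) (δ : ℝ) (B : Fin n → Fin m → ℤ) : Set (Fin m → ZMod N) :=
  {x | x ∈ problems N B ∧
    (∃ w : Fin n → Fin m → ℤ, IsOutputAlgorithmI n δ (publicLattice x) w) ∧
    ∀ w : Fin n → Fin m → ℤ, IsOutputAlgorithmI n δ (publicLattice x) w →
      IsLatticeBasis (completion (hiddenLattice B)) w}

/-- The first `m - n` vectors of every `δ`-LLL-reduced basis of the `N`-orthogonal lattice of the
problem `x` are orthogonal to the hidden lattice, in the order of the reduced basis as well as
after ordering by increasing norm. -/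
def FirstVectorsOrthogonal {n m N : ℕ} (δ : ℝ) (B : Fin n → Fin m → ℤ)
    (x : Fin m → ZMod N) : Prop :=
  ∀ u : Fin m → Fin m → ℤ, IsLLLReducedBasis δ (orthMod (publicLattice x)) u →
    ∀ i : Fin m, (i : ℕ) < m - n →
      u i ∈ orth (hiddenLattice B) ∧
      ∀ τ : Equiv.Perm (Fin m), OrdersByNorm u τ → u (τ i) ∈ orth (hiddenLattice B)

end HiddenLattice

/-! Write `x = F N B a`. An integral vector `u` lies in the `N`-orthogonal lattice of `x` exactly
when `∑ a_i ⟨u, v_i⟩ ≡ 0 (mod N)`, that is, when `q = (⟨u, v_i⟩)_i` is a relation modulo `N` between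
the `a_i`. If `u` is short, then `q` is small by Cauchy–Schwarz. So if `a` satisfies no small
nonzero relation, every short `u` has `q = 0` and is orthogonal to the hidden lattice
(`mem_orth_of_short`).

The vectors computed by LLL are short enough. Generalized cross products of the `v_i` give `m - n`
independent vectors of `ℒ^⊥` of norm at most `∏ ‖v_i‖ ≤ μ^n`, by Hadamard and AM–GM
(`exists_short_vectors_orth`, `prod_norm_le`). They also lie in the `N`-orthogonal lattice, so the
first `m - n` vectors of a reduced basis have squared norm at most `c^(m-1) μ^(2n)`
(`IsLLLReducedBasis.norm_le`), and sorting by norm preserves this bound. Since `‖v_i‖ ≤ √n μ`, the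
relations to exclude have entries at most `R = √n c^((m-1)/2) μ^(n+1)`.

Few `a` satisfy such a relation. Write `q = d q'` with `q'` primitive: each `q'` contributes at most
`d N^(n-1)` vectors `a`, and there are at most `(2R/d + 1)^n` choices of `q'`. Summing over `d`
gives at most `e (√8 R)^n N^(n-1)` bad `a` (`sum_mul_pow_le`), which the logarithmic hypothesis
makes smaller than `ε N^n`.

For the other `a`, the first `m - n` vectors span the orthogonal space of `ℒ`, so their orthogonal
lattice is the completion of `ℒ` (`orth_span_eq_completion`). An output exists because a basis
minimizing the product of the leading Gram determinants becomes LLL-reduced after size reduction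
(`exists_isLLLReducedBasis`). -/

namespace InnerProductSpace

/-! ### Gram–Schmidt orthogonalization and Gram determinants -/

variable {E : Type*} [NormedAddCommGroup E] [InnerProductSpace ℝ E] {k : ℕ}

open Submodule

theorem inner_eq_zero_of_mem_span {s : Set E} {x y : E} (hy : y ∈ span ℝ s)
    (h : ∀ z ∈ s, inner ℝ x z = 0) : inner ℝ x y = 0 := by
  induction hy using Submodule.span_induction with
  | mem z hz => exact h z hz
  | zero => simp
  | add a b _ _ ha hb => rw [inner_add_right, ha, hb, add_zero]
  | smul c a _ ha => rw [inner_smul_right, ha, mul_zero]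

/-- The Gram–Schmidt vector is the only vector that is orthogonal to the preceding vectors and
differs from the given vector by an element of their span. -/
theorem gramSchmidt_eq_of_orthogonal (f : Fin k → E) (i : Fin k) (g : E)
    (h₁ : ∀ j < i, inner ℝ g (f j) = 0) (h₂ : f i - g ∈ span ℝ (f '' Set.Iio i)) :
    gramSchmidt ℝ f i = g := by
  have h₃ : f i - gramSchmidt ℝ f i ∈ span ℝ (f '' Set.Iio i) := by
    rw [← span_gramSchmidt_Iio ℝ f i, gramSchmidt_def ℝ f i, sub_sub_cancel]
    refine Submodule.sum_mem _ fun j hj => ?_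
    rw [starProjection_singleton]
    exact smul_mem _ _ (subset_span ⟨j, by simpa using hj, rfl⟩)
  have h₄ : gramSchmidt ℝ f i - g ∈ span ℝ (f '' Set.Iio i) := by
    have := sub_mem h₂ h₃
    rwa [sub_sub_sub_cancel_left] at this
  have h₅ : inner ℝ (gramSchmidt ℝ f i - g) (gramSchmidt ℝ f i - g) = 0 := by
    refine inner_eq_zero_of_mem_span h₄ ?_
    rintro _ ⟨j, hj, rfl⟩
    rw [inner_sub_left, h₁ j hj, gramSchmidt_inv_triangular ℝ f hj, sub_zero]
  exact sub_eq_zero.1 (inner_self_eq_zero.1 h₅)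

theorem gramSchmidt_congr_of_span {f f' : Fin k → E} {i : Fin k}
    (hs : span ℝ (f' '' Set.Iio i) = span ℝ (f '' Set.Iio i))
    (hi : f' i - f i ∈ span ℝ (f '' Set.Iio i)) :
    gramSchmidt ℝ f' i = gramSchmidt ℝ f i := by
  refine gramSchmidt_eq_of_orthogonal f' i _ (fun j hj => ?_) ?_
  · have : f' j ∈ span ℝ (f '' Set.Iio i) := hs ▸ subset_span ⟨j, hj, rfl⟩
    refine inner_eq_zero_of_mem_span this ?_
    rintro _ ⟨l, hl, rfl⟩
    exact gramSchmidt_inv_triangular ℝ f hl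
  · rw [hs, ← sub_add_sub_cancel (f' i) (f i)]
    refine add_mem hi ?_
    rw [← span_gramSchmidt_Iio ℝ f i, gramSchmidt_def ℝ f i, sub_sub_cancel]
    refine Submodule.sum_mem _ fun j hj => ?_
    rw [starProjection_singleton]
    exact smul_mem _ _ (subset_span ⟨j, by simpa using hj, rfl⟩)

theorem inner_gramSchmidt_self (f : Fin k → E) (i : Fin k) :
    inner ℝ (gramSchmidt ℝ f i) (f i) = ‖gramSchmidt ℝ f i‖ ^ 2 := by
  conv_lhs => rw [gramSchmidt_def' ℝ f i]
  rw [inner_add_right, inner_sum, Finset.sum_eq_zero, add_zero, real_inner_self_eq_norm_sq]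
  intro j hj
  rw [starProjection_singleton, inner_smul_right,
    gramSchmidt_orthogonal ℝ f (Finset.mem_Iio.1 hj).ne', mul_zero]

theorem linearIndependent_of_gramSchmidt_ne_zero {f : Fin k → E}
    (h : ∀ i, gramSchmidt ℝ f i ≠ 0) : LinearIndependent ℝ f := by
  have hg : LinearIndependent ℝ (gramSchmidt ℝ f) :=
    linearIndependent_of_ne_zero_of_inner_eq_zero h fun _ _ => gramSchmidt_orthogonal ℝ f
  rw [linearIndependent_iff_card_eq_finrank_span] at hg ⊢
  rw [hg, Set.finrank, Set.finrank, span_gramSchmidt]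

/-- The expansion of a vector in terms of the Gram–Schmidt vectors. -/
theorem sum_inner_gramSchmidt (f : Fin k → E) (hf : LinearIndependent ℝ f) (i : Fin k) :
    f i = ∑ p, (inner ℝ (gramSchmidt ℝ f p) (f i) / ‖gramSchmidt ℝ f p‖ ^ 2) •
      gramSchmidt ℝ f p := by
  conv_lhs => rw [gramSchmidt_def'' ℝ f i]
  have h : ∀ p ∈ Finset.univ, p ∉ Finset.Iic i →
      (inner ℝ (gramSchmidt ℝ f p) (f i) / ‖gramSchmidt ℝ f p‖ ^ 2) • gramSchmidt ℝ f p = 0 := by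
    intro p _ hp
    rw [gramSchmidt_inv_triangular ℝ f (by simpa using hp), zero_div, zero_smul]
  rw [← Finset.sum_subset (Finset.subset_univ _) h, ← Finset.Iio_insert,
    Finset.sum_insert (by simp), inner_gramSchmidt_self, div_self, one_smul]
  · rfl
  · exact pow_ne_zero _ (norm_ne_zero_iff.2 (gramSchmidt_ne_zero i hf))

/-- The leading Gram determinants are products of squared Gram–Schmidt norms. -/
theorem det_gram_initial (f : Fin k → E) (hf : LinearIndependent ℝ f) (l : Fin k) :
    (Matrix.of fun i j : {p : Fin k // p ≤ l} => (inner ℝ (f i) (f j) : ℝ)).det =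
      ∏ p ∈ Finset.Iic l, ‖gramSchmidt ℝ f p‖ ^ 2 := by
  set g := gramSchmidt ℝ f with hg
  have hg0 : ∀ p, ‖g p‖ ^ 2 ≠ 0 := fun p =>
    pow_ne_zero _ (norm_ne_zero_iff.2 (gramSchmidt_ne_zero p hf))
  -- The Gram matrix factors as `T D Tᵀ`, with `T` lower unitriangular (the Gram–Schmidt
  -- coefficients) and `D` the diagonal matrix of squared norms.
  let T : Matrix {p : Fin k // p ≤ l} {p : Fin k // p ≤ l} ℝ :=
    Matrix.of fun i p => inner ℝ (g p) (f i) / ‖g p‖ ^ 2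
  have hT : T.det = 1 := by
    rw [Matrix.det_of_isLowerTriangular]
    · refine Finset.prod_eq_one fun i _ => ?_
      simp only [T, Matrix.of_apply]
      rw [hg, inner_gramSchmidt_self, div_self (hg0 i)]
    · intro i j hij
      simp only [T, Matrix.of_apply]
      rw [hg, gramSchmidt_inv_triangular ℝ f (by simpa using hij), zero_div]
  have hG : (Matrix.of fun i j : {p : Fin k // p ≤ l} => (inner ℝ (f i) (f j) : ℝ)) =
      T * Matrix.diagonal (fun p : {p : Fin k // p ≤ l} => ‖g p‖ ^ 2) * T.transpose := by
    ext i j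
    rw [Matrix.mul_apply]
    simp only [Matrix.mul_diagonal, Matrix.of_apply, Matrix.transpose_apply, T]
    conv_lhs => rw [sum_inner_gramSchmidt f hf i, sum_inner]
    rw [← Finset.sum_subset (Finset.subset_univ (Finset.Iic l))]
    · rw [← Finset.sum_subtype (Finset.Iic l) (p := fun p => p ≤ l) (by simp)
        (fun p => inner ℝ (g p) (f i) / ‖g p‖ ^ 2 * ‖g p‖ ^ 2 * (inner ℝ (g p) (f j) / ‖g p‖ ^ 2))]
      refine Finset.sum_congr rfl fun p _ => ?_
      rw [inner_smul_left]
      have := hg0 p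
      simp only [← hg, RCLike.conj_to_real]
      field_simp
    · intro p _ hp
      rw [gramSchmidt_inv_triangular ℝ f (i := i.1), zero_div, zero_smul, inner_zero_left]
      exact lt_of_le_of_lt i.2 (by simpa using hp)
  rw [hG, Matrix.det_mul, Matrix.det_mul, Matrix.det_transpose, hT, Matrix.det_diagonal, one_mul,
    mul_one, ← Finset.prod_subtype (Finset.Iic l) (p := fun p => p ≤ l) (by simp)
      (fun p => ‖g p‖ ^ 2)]

end InnerProductSpace

/-! ### Integral vectors in Euclidean space, size reduction, existence of LLL-reduced bases -/

namespace HiddenLattice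

open Submodule InnerProductSpace

/-- `toEuclidean` as an additive map. -/
noncomputable def toEuclideanHom (m : ℕ) : (Fin m → ℤ) →ₗ[ℤ] EuclideanSpace ℝ (Fin m) where
  toFun := toEuclidean
  map_add' v w := by ext i; simp [toEuclidean]
  map_smul' c v := by ext i; simp [toEuclidean]

theorem toEuclidean_sub {m : ℕ} (v w : Fin m → ℤ) :
    toEuclidean (v - w) = toEuclidean v - toEuclidean w := (toEuclideanHom m).map_sub v w

theorem toEuclidean_smul {m : ℕ} (z : ℤ) (v : Fin m → ℤ) :
    toEuclidean (z • v) = (z : ℝ) • toEuclidean v := by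
  ext i; simp [toEuclidean]

theorem toEuclidean_sum {ι : Type*} {m : ℕ} (s : Finset ι) (v : ι → Fin m → ℤ) :
    toEuclidean (∑ i ∈ s, v i) = ∑ i ∈ s, toEuclidean (v i) := map_sum (toEuclideanHom m) v s

theorem inner_toEuclidean {m : ℕ} (v w : Fin m → ℤ) :
    inner ℝ (toEuclidean v) (toEuclidean w) = ((v ⬝ᵥ w : ℤ) : ℝ) := by
  simp [toEuclidean, PiLp.inner_apply, dotProduct, mul_comm]

theorem norm_toEuclidean_sq {m : ℕ} (v : Fin m → ℤ) :
    ‖toEuclidean v‖ ^ 2 = ((v ⬝ᵥ v : ℤ) : ℝ) := by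
  rw [← inner_toEuclidean, real_inner_self_eq_norm_sq]

theorem toEuclidean_mem_span {m : ℕ} {s : Set (Fin m → ℤ)} {w : Fin m → ℤ} (h : w ∈ span ℤ s) :
    toEuclidean w ∈ span ℝ (toEuclidean '' s) := by
  have h₁ : toEuclideanHom m w ∈ (span ℤ s).map (toEuclideanHom m) := mem_map_of_mem h
  rw [map_span] at h₁
  exact span_le_restrictScalars ℤ ℝ _ h₁

/-- The Gram matrix is integral: if it is singular, it kills a nonzero integral vector `z`, and then
`∑ z_i b_i` has norm zero, which is a relation over `ℤ`. -/
theorem linearIndependent_toEuclidean_iff {ι : Type*} [Finite ι] {m : ℕ} {b : ι → Fin m → ℤ} :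
    LinearIndependent ℝ (fun i => toEuclidean (b i)) ↔ LinearIndependent ℤ b := by
  classical
  have := Fintype.ofFinite ι
  constructor
  · intro h
    have h' := h.restrict_scalars (R := ℤ) (by
      intro x y hxy
      simpa using hxy)
    exact LinearIndependent.of_comp (toEuclideanHom m) h'
  · intro h
    rw [← Matrix.det_gram_ne_zero_iff_linearIndependent (𝕜 := ℝ)]
    have hG : Matrix.gram ℝ (fun i => toEuclidean (b i)) =
        (Matrix.of fun i j => b i ⬝ᵥ b j : Matrix ι ι ℤ).map (Int.castRingHom ℝ) := by
      ext i j
      simp [Matrix.gram_apply, inner_toEuclidean]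
    rw [hG, ← RingHom.mapMatrix_apply, ← RingHom.map_det]
    simp only [eq_intCast, ne_eq, Int.cast_eq_zero]
    intro h0
    obtain ⟨z, hz, hzG⟩ := Matrix.exists_mulVec_eq_zero_iff.2 h0
    have h1 : (∑ i, z i • b i) ⬝ᵥ (∑ i, z i • b i) = 0 := by
      rw [sum_dotProduct]
      refine Finset.sum_eq_zero fun i _ => ?_
      have := congrFun hzG i
      rw [smul_dotProduct, dotProduct_sum]
      simp only [Matrix.mulVec, dotProduct, Matrix.of_apply, Pi.zero_apply] at this
      simp only [dotProduct_smul, smul_eq_mul]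
      simp only [dotProduct, mul_comm (z _)]
      rw [this, zero_mul]
    rw [dotProduct_self_eq_zero] at h1
    exact hz (funext (Fintype.linearIndependent_iff.1 h z h1))

theorem span_image_Iio_of_sub_mem {R M : Type*} [Ring R] [AddCommGroup M] [Module R M] {k : ℕ}
    {b b' : Fin k → M} (h : ∀ i, b' i - b i ∈ span R (b '' Set.Iio i)) (i : Fin k) :
    span R (b' '' Set.Iio i) = span R (b '' Set.Iio i) := by
  induction i using WellFoundedLT.induction with
  | ind i ih =>
    apply le_antisymm <;> rw [span_le] <;> rintro _ ⟨j, hj, rfl⟩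
    · have hm : span R (b '' Set.Iio j) ≤ span R (b '' Set.Iio i) :=
        span_mono (Set.image_mono (Set.Iio_subset_Iio (le_of_lt hj)))
      have h₁ := add_mem (hm (h j)) (subset_span (s := b '' Set.Iio i) ⟨j, hj, rfl⟩)
      rwa [sub_add_cancel] at h₁
    · have hm : span R (b' '' Set.Iio j) ≤ span R (b' '' Set.Iio i) :=
        span_mono (Set.image_mono (Set.Iio_subset_Iio (le_of_lt hj)))
      have h₀ := h j
      rw [← ih j hj] at h₀
      have h₁ := sub_mem (subset_span (s := b' '' Set.Iio i) ⟨j, hj, rfl⟩) (hm h₀)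
      rwa [sub_sub_cancel] at h₁

theorem span_range_of_sub_mem {R M : Type*} [Ring R] [AddCommGroup M] [Module R M] {k : ℕ}
    {b b' : Fin k → M} (h : ∀ i, b' i - b i ∈ span R (b '' Set.Iio i)) :
    span R (Set.range b') = span R (Set.range b) := by
  apply le_antisymm <;> rw [span_le] <;> rintro _ ⟨j, rfl⟩
  · have h₁ := add_mem (span_mono (Set.image_subset_range b _) (h j))
      (subset_span (s := Set.range b) ⟨j, rfl⟩)
    rwa [sub_add_cancel] at h₁
  · have h₀ := h j
    rw [← span_image_Iio_of_sub_mem h] at h₀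
    have h₁ := sub_mem (subset_span (s := Set.range b') ⟨j, rfl⟩)
      (span_mono (Set.image_subset_range b' _) h₀)
    rwa [sub_sub_cancel] at h₁

theorem gsVec_ne_zero {k m : ℕ} {b : Fin k → Fin m → ℤ} (hb : LinearIndependent ℤ b) (i : Fin k) :
    gsVec b i ≠ 0 :=
  gramSchmidt_ne_zero i (linearIndependent_toEuclidean_iff.2 hb)

theorem gsVec_inner_eq_zero {k m : ℕ} (b : Fin k → Fin m → ℤ) {i j : Fin k} (h : i < j) :
    inner ℝ (toEuclidean (b i)) (gsVec b j) = 0 := by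
  rw [real_inner_comm]
  exact gramSchmidt_inv_triangular ℝ _ h

theorem gsVec_inner_self {k m : ℕ} (b : Fin k → Fin m → ℤ) (i : Fin k) :
    inner ℝ (toEuclidean (b i)) (gsVec b i) = ‖gsVec b i‖ ^ 2 := by
  rw [real_inner_comm]
  exact inner_gramSchmidt_self _ _

/-- Each vector of a basis can be size-reduced against the preceding ones. -/
theorem exists_sizeReduction {k m : ℕ} {b : Fin k → Fin m → ℤ} (hb : LinearIndependent ℤ b)
    (i : Fin k) : ∃ w ∈ span ℤ (b '' Set.Iio i), ∀ j < i,
      |inner ℝ (toEuclidean (b i - w)) (gsVec b j) / ‖gsVec b j‖ ^ 2| ≤ 1 / 2 := by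
  -- The coefficients are reduced from index `i - 1` downwards. Subtracting a multiple of `b_p`
  -- leaves those of index above `p` unchanged, since `b_p` is orthogonal to the later Gram–Schmidt
  -- vectors.
  suffices H : ∀ s : ℕ, ∃ w ∈ span ℤ (b '' Set.Iio i), ∀ j < i, (i : ℕ) ≤ j + s →
      |inner ℝ (toEuclidean (b i - w)) (gsVec b j) / ‖gsVec b j‖ ^ 2| ≤ 1 / 2 by
    obtain ⟨w, hw, h⟩ := H i
    exact ⟨w, hw, fun j hj => h j hj (Nat.le_add_left _ _)⟩
  intro s
  induction s with
  | zero =>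
    refine ⟨0, zero_mem _, fun j hj h => ?_⟩
    have : (j : ℕ) < i := hj
    omega
  | succ s ih =>
    obtain ⟨w, hw, h⟩ := ih
    by_cases hs : s < (i : ℕ)
    · let p : Fin k := ⟨i - (s + 1), by omega⟩
      have hp : (p : ℕ) = i - (s + 1) := rfl
      have hpi : p < i := by rw [Fin.lt_def]; omega
      set r : ℝ := inner ℝ (toEuclidean (b i - w)) (gsVec b p) / ‖gsVec b p‖ ^ 2 with hr
      refine ⟨w + round r • b p, add_mem hw (smul_mem _ _ (subset_span ⟨p, hpi, rfl⟩)), ?_⟩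
      intro j hj hjs
      have hpj : p ≤ j := by rw [Fin.le_def]; omega
      rw [← sub_sub, toEuclidean_sub, toEuclidean_smul, inner_sub_left, inner_smul_left,
        RCLike.conj_to_real]
      rcases hpj.eq_or_lt with rfl | hlt
      · rw [gsVec_inner_self, sub_div, mul_div_cancel_right₀ _
          (pow_ne_zero _ (norm_ne_zero_iff.2 (gsVec_ne_zero hb p)))]
        exact abs_sub_round r
      · rw [gsVec_inner_eq_zero b hlt, mul_zero, sub_zero]
        refine h j hj ?_
        have : (p : ℕ) < j := hlt
        omega
    · refine ⟨w, hw, fun j hj hjs => h j hj ?_⟩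
      have : (j : ℕ) < i := hj
      omega

/-- Every lattice basis can be size-reduced without changing its Gram–Schmidt vectors. -/
theorem exists_sizeReduced_basis {k m : ℕ} {Λ : Lat m} {b : Fin k → Fin m → ℤ}
    (hb : IsLatticeBasis Λ b) : ∃ b' : Fin k → Fin m → ℤ, IsLatticeBasis Λ b' ∧
      gsVec b' = gsVec b ∧ ∀ i j : Fin k, j < i → |gsCoeff b' i j| ≤ 1 / 2 := by
  choose w hw h using exists_sizeReduction hb.1
  have hsub : ∀ i, (b i - w i) - b i ∈ span ℤ (b '' Set.Iio i) := fun i => by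
    rw [sub_sub_cancel_left]; exact neg_mem (hw i)
  have hsubE : ∀ i, toEuclidean (b i - w i) - toEuclidean (b i) ∈
      span ℝ ((fun i => toEuclidean (b i)) '' Set.Iio i) := fun i => by
    rw [← toEuclidean_sub]
    have := toEuclidean_mem_span (hsub i)
    rwa [Set.image_image] at this
  have hgs : gsVec (fun i => b i - w i) = gsVec b := by
    funext i
    exact gramSchmidt_congr_of_span (span_image_Iio_of_sub_mem hsubE i) (hsubE i)
  refine ⟨fun i => b i - w i, ⟨?_, ?_⟩, hgs, fun i j hij => ?_⟩
  · rw [← linearIndependent_toEuclidean_iff]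
    refine linearIndependent_of_gramSchmidt_ne_zero fun i => ?_
    have := congrFun hgs i
    rw [gsVec] at this
    rw [this]
    exact gsVec_ne_zero hb.1 i
  · rw [span_range_of_sub_mem hsub, hb.2]
  · rw [gsCoeff, hgs]
    exact h i j hij

/-- The Gram determinant of the vectors `b_j`, `j ≤ l`. -/
def initialGramDet {k m : ℕ} (b : Fin k → Fin m → ℤ) (l : Fin k) : ℤ :=
  (Matrix.of fun i j : {p : Fin k // p ≤ l} => b i ⬝ᵥ b j).det

theorem initialGramDet_eq {k m : ℕ} {b : Fin k → Fin m → ℤ} (hb : LinearIndependent ℤ b)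
    (l : Fin k) : (initialGramDet b l : ℝ) = ∏ p ∈ Finset.Iic l, ‖gsVec b p‖ ^ 2 := by
  have := det_gram_initial _ (linearIndependent_toEuclidean_iff.2 hb) l
  rw [show (∏ p ∈ Finset.Iic l, ‖gsVec b p‖ ^ 2) = _ from this.symm, initialGramDet,
    ← eq_intCast (Int.castRingHom ℝ), RingHom.map_det]
  congr 1
  ext i j
  simp [inner_toEuclidean]

theorem initialGramDet_pos {k m : ℕ} {b : Fin k → Fin m → ℤ} (hb : LinearIndependent ℤ b)
    (l : Fin k) : 0 < initialGramDet b l := by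
  have : (0 : ℝ) < initialGramDet b l := by
    rw [initialGramDet_eq hb]
    exact Finset.prod_pos fun p _ => pow_pos (norm_pos_iff.2 (gsVec_ne_zero hb p)) 2
  exact_mod_cast this

theorem initialGramDet_comp_perm {k m : ℕ} (b : Fin k → Fin m → ℤ) (l : Fin k)
    (σ : Equiv.Perm (Fin k)) (hσ : ∀ p, p ≤ l ↔ σ p ≤ l) :
    initialGramDet (b ∘ σ) l = initialGramDet b l := by
  rw [initialGramDet, initialGramDet]
  rw [← Matrix.det_submatrix_equiv_self (σ.subtypePerm (p := fun p => p ≤ l) fun p => (hσ p).symm)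
    (Matrix.of fun i j : {p : Fin k // p ≤ l} => b i ⬝ᵥ b j)]
  rfl

theorem isLatticeBasis_comp_perm {k m : ℕ} {Λ : Lat m} {b : Fin k → Fin m → ℤ}
    (hb : IsLatticeBasis Λ b) (σ : Equiv.Perm (Fin k)) : IsLatticeBasis Λ (b ∘ σ) :=
  ⟨hb.1.comp σ σ.injective, by rw [Set.range_comp, σ.range_eq_univ, Set.image_univ, hb.2]⟩

theorem gsVec_swap_of_lt {k m : ℕ} (b : Fin k → Fin m → ℤ) {i j p : Fin k} (hij : i < j)
    (hp : p < i) : gsVec (b ∘ Equiv.swap i j) p = gsVec b p := by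
  have hfix : ∀ q ≤ p, Equiv.swap i j q = q := fun q hq =>
    Equiv.swap_apply_of_ne_of_ne (hq.trans_lt hp).ne ((hq.trans_lt hp).trans hij).ne
  refine gramSchmidt_congr_of_span (congrArg _ (Set.image_congr fun q hq => ?_)) ?_
  · simp only [Function.comp_apply, hfix q (le_of_lt hq)]
  · simp [hfix p le_rfl]

/-- This identifies the right side of the Lovász condition: it is the squared norm of the `i`-th
Gram–Schmidt vector after exchanging `b_i` and `b_j`. Both vectors are the component of `b_j`
orthogonal to the `b_q` with `q < i`. -/
theorem gsVec_swap {k m : ℕ} (b : Fin k → Fin m → ℤ) {i j : Fin k} (hij : (j : ℕ) = i + 1) :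
    gsVec (b ∘ Equiv.swap i j) i = gsVec b j + gsCoeff b j i • gsVec b i := by
  have hlt : i < j := by rw [Fin.lt_def]; omega
  have hfix : ∀ q < i, Equiv.swap i j q = q := fun q hq =>
    Equiv.swap_apply_of_ne_of_ne hq.ne (hq.trans hlt).ne
  refine gramSchmidt_eq_of_orthogonal _ i _ (fun p hp => ?_) ?_
  · rw [Function.comp_apply, hfix p hp, real_inner_comm, inner_add_right, inner_smul_right,
      gsVec_inner_eq_zero b (hp.trans hlt), gsVec_inner_eq_zero b hp, mul_zero, add_zero]
  · have himg : (fun q => toEuclidean ((b ∘ Equiv.swap i j) q)) '' Set.Iio i =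
        (fun q => toEuclidean (b q)) '' Set.Iio i :=
      Set.image_congr fun q hq => by simp only [Function.comp_apply, hfix q hq]
    rw [himg, ← span_gramSchmidt_Iio, Function.comp_apply, Equiv.swap_apply_left]
    have hIio : Finset.Iio j = insert i (Finset.Iio i) := by
      ext q
      simp only [Finset.mem_Iio, Finset.mem_insert, Fin.lt_def, Fin.ext_iff]
      omega
    have h := gramSchmidt_def'' ℝ (fun q => toEuclidean (b q)) j
    rw [hIio, Finset.sum_insert (by simp), ← add_assoc] at h
    have h' : toEuclidean (b j) - (gsVec b j + gsCoeff b j i • gsVec b i) =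
        ∑ q ∈ Finset.Iio i, (inner ℝ (gsVec b q) (toEuclidean (b j)) / ‖gsVec b q‖ ^ 2) •
          gsVec b q := by
      rw [sub_eq_iff_eq_add', gsCoeff, real_inner_comm]
      exact h
    rw [h']
    exact sum_mem fun q hq => smul_mem _ _ (subset_span ⟨q, by simpa using hq, rfl⟩)

/-- Every lattice that has a basis has a `δ`-LLL-reduced basis. -/
theorem exists_isLLLReducedBasis {k m : ℕ} {Λ : Lat m} {b₀ : Fin k → Fin m → ℤ}
    (hb₀ : IsLatticeBasis Λ b₀) {δ : ℝ} (hδ : δ ≤ 1) :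
    ∃ b : Fin k → Fin m → ℤ, IsLLLReducedBasis δ Λ b := by
  -- The LLL potential. It is a positive integer on bases and depends only on the Gram–Schmidt
  -- norms, so size-reducing a minimizer keeps it minimal.
  let P : (Fin k → Fin m → ℤ) → ℕ := fun b => ∏ l, (initialGramDet b l).toNat
  obtain ⟨b₁, hb₁, hmin⟩ := exists_minimalFor_of_wellFoundedLT
    (fun b : Fin k → Fin m → ℤ => IsLatticeBasis Λ b) P ⟨b₀, hb₀⟩
  obtain ⟨b, hb, hgs, hsize⟩ := exists_sizeReduced_basis hb₁
  have hdet : ∀ l, initialGramDet b l = initialGramDet b₁ l := fun l => by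
    have : (initialGramDet b l : ℝ) = initialGramDet b₁ l := by
      rw [initialGramDet_eq hb.1, initialGramDet_eq hb₁.1, hgs]
    exact_mod_cast this
  refine ⟨b, hb, hsize, fun i j hij => ?_⟩
  rw [← gsVec_swap b hij]
  have hlt : i < j := by rw [Fin.lt_def]; omega
  set b' := b ∘ Equiv.swap i j with hb'
  have hbas := isLatticeBasis_comp_perm hb (Equiv.swap i j)
  have hP : P b ≤ P b' := by
    have hPb : P b = P b₁ := Finset.prod_congr rfl fun l _ => by rw [hdet]
    rw [hPb]
    exact (le_total (P b₁) (P b')).elim id (hmin hbas)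
  -- An exchange of neighbours permutes `{p ≤ l}` unless `l = i`, so only the `i`-th determinant can
  -- change.
  have hoff : ∀ l, l ≠ i → initialGramDet b' l = initialGramDet b l := by
    intro l hl
    refine initialGramDet_comp_perm b l _ fun p => ?_
    rw [Equiv.swap_apply_def]
    have hl' : (l : ℕ) ≠ i := fun h => hl (Fin.ext h)
    split_ifs with h1 h2
    · subst h1; rw [Fin.le_def, Fin.le_def]; omega
    · subst h2; rw [Fin.le_def, Fin.le_def]; omega
    · rfl
  have hi : initialGramDet b i ≤ initialGramDet b' i := by
    simp only [P] at hP
    rw [← Finset.mul_prod_erase _ _ (Finset.mem_univ i),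
      ← Finset.mul_prod_erase _ _ (Finset.mem_univ i),
      Finset.prod_congr rfl (fun l hl => by rw [hoff l (Finset.ne_of_mem_erase hl)] :
        ∀ l ∈ Finset.univ.erase i, (initialGramDet b' l).toNat = (initialGramDet b l).toNat)] at hP
    have hpos : 0 < ∏ l ∈ Finset.univ.erase i, (initialGramDet b l).toNat :=
      Finset.prod_pos fun l _ => by have := initialGramDet_pos hb.1 l; omega
    have := Nat.le_of_mul_le_mul_right hP hpos
    have := initialGramDet_pos hb.1 i
    have := initialGramDet_pos hbas.1 i
    omega
  have hiR : (initialGramDet b i : ℝ) ≤ initialGramDet b' i := by exact_mod_cast hi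
  rw [initialGramDet_eq hb.1, initialGramDet_eq hbas.1, ← Finset.Iio_insert,
    Finset.prod_insert (by simp), Finset.prod_insert (by simp),
    Finset.prod_congr rfl (fun p hp => by
      rw [gsVec_swap_of_lt b hlt (Finset.mem_Iio.1 hp)] :
      ∀ p ∈ Finset.Iio i, ‖gsVec (b ∘ Equiv.swap i j) p‖ ^ 2 = ‖gsVec b p‖ ^ 2)] at hiR
  have hpos : 0 < ∏ p ∈ Finset.Iio i, ‖gsVec b p‖ ^ 2 :=
    Finset.prod_pos fun p _ => pow_pos (norm_pos_iff.2 (gsVec_ne_zero hb.1 p)) 2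
  have h := le_of_mul_le_mul_right hiR hpos
  -- Minimality gives the Lovász condition with parameter 1, hence with every `δ ≤ 1`.
  exact (mul_le_of_le_one_left (sq_nonneg _) hδ).trans h

end HiddenLattice

/-! ### Length bounds for LLL-reduced bases -/

namespace HiddenLattice

open Submodule InnerProductSpace

/-- By Pythagoras the right side of the Lovász condition is `‖b_j^*‖²` plus at most `‖b_i^*‖² / 4`,
since the coefficient is at most 1/2 in absolute value. -/
theorem IsLLLReducedBasis.norm_gsVec_succ {k m : ℕ} {δ : ℝ} {Λ : Lat m} {b : Fin k → Fin m → ℤ}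
    (hb : IsLLLReducedBasis δ Λ b) (hδ : 1 / 4 < δ) {i j : Fin k} (hij : (j : ℕ) = i + 1) :
    ‖gsVec b i‖ ^ 2 ≤ (δ - 1 / 4)⁻¹ * ‖gsVec b j‖ ^ 2 := by
  have hlt : i < j := by rw [Fin.lt_def]; omega
  have h₁ := hb.lovasz i j hij
  have horth : inner ℝ (gsVec b j) (gsVec b i) = 0 := gramSchmidt_orthogonal ℝ _ hlt.ne'
  rw [@norm_add_sq ℝ, inner_smul_right, horth, norm_smul, mul_pow, Real.norm_eq_abs] at h₁
  have h₂ : |gsCoeff b j i| ^ 2 ≤ (1 / 2) ^ 2 :=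
    pow_le_pow_left₀ (abs_nonneg _) (hb.sizeReduced j i hlt) 2
  have h₃ := mul_le_mul_of_nonneg_right h₂ (sq_nonneg ‖gsVec b i‖)
  rw [inv_mul_eq_div, le_div_iff₀ (by linarith)]
  simp only [mul_zero, map_zero, add_zero] at h₁
  linarith

theorem IsLLLReducedBasis.norm_gsVec_le {k m : ℕ} {δ : ℝ} {Λ : Lat m} {b : Fin k → Fin m → ℤ}
    (hb : IsLLLReducedBasis δ Λ b) (hδ : 1 / 4 < δ) (s : ℕ) {i j : Fin k}
    (hij : (j : ℕ) = i + s) :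
    ‖gsVec b i‖ ^ 2 ≤ (δ - 1 / 4)⁻¹ ^ s * ‖gsVec b j‖ ^ 2 := by
  induction s generalizing j with
  | zero =>
    have : j = i := Fin.ext (by omega)
    simp [this]
  | succ s ih =>
    have h₁ := ih (j := ⟨i + s, by omega⟩) rfl
    have h₂ := hb.norm_gsVec_succ hδ (i := ⟨i + s, by omega⟩) (j := j) (by simp; omega)
    have hc : 0 ≤ (δ - 1 / 4)⁻¹ ^ s := pow_nonneg (inv_nonneg.2 (by linarith)) s
    calc _ ≤ _ := h₁
      _ ≤ (δ - 1 / 4)⁻¹ ^ s * ((δ - 1 / 4)⁻¹ * ‖gsVec b j‖ ^ 2) := by gcongr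
      _ = _ := by ring

theorem norm_sq_eq_sum_gsCoeff {k m : ℕ} (b : Fin k → Fin m → ℤ) (j : Fin k) :
    ‖toEuclidean (b j)‖ ^ 2 =
      ‖gsVec b j‖ ^ 2 + ∑ i ∈ Finset.Iio j, gsCoeff b j i ^ 2 * ‖gsVec b i‖ ^ 2 := by
  have h := gramSchmidt_def'' ℝ (fun q => toEuclidean (b q)) j
  have h' : toEuclidean (b j) =
      gsVec b j + ∑ i ∈ Finset.Iio j, gsCoeff b j i • gsVec b i := by
    simp only [gsCoeff, real_inner_comm]
    exact h
  conv_lhs => rw [h', ← real_inner_self_eq_norm_sq]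
  have hz : ∀ i ∈ Finset.Iio j, inner ℝ (gsVec b j) (gsCoeff b j i • gsVec b i) = (0 : ℝ) :=
    fun i hi => by
      rw [inner_smul_right, gsVec, gsVec,
        gramSchmidt_orthogonal ℝ _ (Finset.mem_Iio.1 hi).ne', mul_zero]
  have h0 : inner ℝ (gsVec b j) (∑ i ∈ Finset.Iio j, gsCoeff b j i • gsVec b i) = (0 : ℝ) := by
    rw [inner_sum, Finset.sum_eq_zero hz]
  rw [inner_add_left, inner_add_right, inner_add_right, real_inner_comm (gsVec b j) (∑ i ∈ _, _),
    h0, real_inner_self_eq_norm_sq, add_zero, zero_add, sum_inner]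
  congr 1
  refine Finset.sum_congr rfl fun i hi => ?_
  rw [inner_sum, Finset.sum_eq_single_of_mem i hi, inner_smul_left, inner_smul_right,
    real_inner_self_eq_norm_sq, RCLike.conj_to_real]
  · ring
  · intro l _ hl
    rw [inner_smul_left, inner_smul_right, gsVec, gsVec, gramSchmidt_orthogonal ℝ _ hl.symm,
      mul_zero, mul_zero]

/-- The induction step needs `c^j ≤ (3/4) c^(j+1)`, which is the condition `c ≥ 4/3`; for `c = (δ -
1/4)⁻¹` this is `δ ≤ 1`. -/
theorem one_add_sum_pow_le {c : ℝ} (hc : 4 / 3 ≤ c) (j : ℕ) :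
    1 + 1 / 4 * ∑ i ∈ Finset.range j, c ^ (i + 1) ≤ c ^ j := by
  induction j with
  | zero => simp
  | succ j ih =>
    rw [Finset.sum_range_succ]
    have h : 0 ≤ c ^ j := pow_nonneg (by linarith) j
    rw [pow_succ]
    nlinarith

/-- In the orthogonal expansion of `b_j`, the term of index `i < j` is at most `(1/4) c^(j-i)
‖b_j^*‖²`; the geometric sum is then absorbed into `c^j`. -/
theorem IsLLLReducedBasis.norm_le_gsVec {k m : ℕ} {δ : ℝ} {Λ : Lat m} {b : Fin k → Fin m → ℤ}
    (hb : IsLLLReducedBasis δ Λ b) (hδ : 1 / 4 < δ) (hδ1 : δ ≤ 1) (j : Fin k) :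
    ‖toEuclidean (b j)‖ ^ 2 ≤ (δ - 1 / 4)⁻¹ ^ (j : ℕ) * ‖gsVec b j‖ ^ 2 := by
  set c := (δ - 1 / 4)⁻¹ with hc
  have hc43 : 4 / 3 ≤ c := by
    rw [hc, le_inv_comm₀ (by norm_num) (by linarith)]
    linarith
  rw [norm_sq_eq_sum_gsCoeff]
  have h₁ : ∀ i ∈ Finset.Iio j, gsCoeff b j i ^ 2 * ‖gsVec b i‖ ^ 2 ≤
      1 / 4 * (c ^ ((j : ℕ) - i) * ‖gsVec b j‖ ^ 2) := fun i hi => by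
    have hi' : i < j := Finset.mem_Iio.1 hi
    rw [Fin.lt_def] at hi'
    have h₂ : |gsCoeff b j i| ^ 2 ≤ (1 / 2) ^ 2 :=
      pow_le_pow_left₀ (abs_nonneg _) (hb.sizeReduced j i (Finset.mem_Iio.1 hi)) 2
    rw [sq_abs] at h₂
    have h₃ := hb.norm_gsVec_le hδ ((j : ℕ) - i) (i := i) (j := j) (by omega)
    refine mul_le_mul (by linarith) h₃ (sq_nonneg _) (by norm_num)
  have h₄ : ∑ i ∈ Finset.Iio j, c ^ ((j : ℕ) - i) = ∑ i ∈ Finset.range j, c ^ (i + 1) := by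
    rw [← Finset.sum_range_reflect]
    refine Finset.sum_bij (fun i _ => (i : ℕ)) ?_ ?_ ?_ ?_
    · intro i hi; simpa using hi
    · intro i _ i' _ h; exact Fin.ext h
    · intro i hi
      have : i < (j : ℕ) := by simpa using hi
      exact ⟨⟨i, by omega⟩, by simpa [Fin.lt_def] using this, rfl⟩
    · intro i hi
      have : i < j := Finset.mem_Iio.1 hi
      rw [Fin.lt_def] at this
      congr 1
      omega
  calc _ ≤ ‖gsVec b j‖ ^ 2 + ∑ i ∈ Finset.Iio j, 1 / 4 * (c ^ ((j : ℕ) - i) * ‖gsVec b j‖ ^ 2) := by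
        exact add_le_add_right (Finset.sum_le_sum h₁) _
    _ = (1 + 1 / 4 * ∑ i ∈ Finset.range j, c ^ (i + 1)) * ‖gsVec b j‖ ^ 2 := by
        rw [← Finset.mul_sum, ← Finset.sum_mul, h₄]; ring
    _ ≤ _ := by gcongr; exact one_add_sum_pow_le hc43 j

/-- A lattice vector outside the span of the first `p` basis vectors is at least as long as some
Gram–Schmidt vector of index at least `p`. -/
theorem exists_norm_gsVec_le {k m : ℕ} (b : Fin k → Fin m → ℤ) {t : Fin m → ℤ}
    (ht : t ∈ span ℤ (Set.range b)) {p : ℕ} (hp : t ∉ span ℤ (b '' {i | (i : ℕ) < p})) :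
    ∃ i : Fin k, p ≤ i ∧ ‖gsVec b i‖ ≤ ‖toEuclidean t‖ := by
  obtain ⟨z, hz⟩ := (mem_span_range_iff_exists_fun ℤ).1 ht
  have hne : (Finset.univ.filter fun i : Fin k => z i ≠ 0 ∧ p ≤ i).Nonempty := by
    by_contra hcon
    rw [Finset.not_nonempty_iff_eq_empty, Finset.filter_eq_empty_iff] at hcon
    refine hp ?_
    rw [← hz]
    refine sum_mem fun i _ => ?_
    by_cases hzi : z i = 0
    · rw [hzi, zero_smul]; exact zero_mem _
    · exact smul_mem _ _ (subset_span ⟨i, by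
        have := hcon (Finset.mem_univ i); simp only [not_and, not_le] at this; exact this hzi, rfl⟩)
  -- For the largest index `i` with `z_i ≠ 0`, only that term survives in `⟨t, b_i^*⟩ = z_i
  -- ‖b_i^*‖²`, and `|z_i| ≥ 1`.
  obtain ⟨i, hi, hmax⟩ := Finset.exists_max_image _ id hne
  simp only [Finset.mem_filter, Finset.mem_univ, true_and, id] at hi hmax
  refine ⟨i, hi.2, ?_⟩
  rcases eq_or_ne (gsVec b i) 0 with h0 | h0
  · rw [h0, norm_zero]; exact norm_nonneg _
  have hin : inner ℝ (toEuclidean t) (gsVec b i) = z i * ‖gsVec b i‖ ^ 2 := by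
    rw [← hz, toEuclidean_sum, sum_inner, Finset.sum_eq_single i]
    · rw [toEuclidean_smul, inner_smul_left, gsVec_inner_self, RCLike.conj_to_real]
    · intro j _ hj
      rw [toEuclidean_smul, inner_smul_left]
      rcases lt_or_gt_of_ne hj with hlt | hgt
      · rw [gsVec_inner_eq_zero b hlt, mul_zero]
      · have : z j = 0 := by
          by_contra hzj
          have h₁ : (i : ℕ) < j := hgt
          exact absurd (hmax j ⟨hzj, by omega⟩) (not_le.2 hgt)
        simp [this]
    · simp
  have hle := abs_real_inner_le_norm (toEuclidean t) (gsVec b i)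
  rw [hin, abs_mul, abs_of_nonneg (sq_nonneg ‖gsVec b i‖), sq, ← mul_assoc] at hle
  have hle' := le_of_mul_le_mul_right hle (norm_pos_iff.2 h0)
  have h1 : (1 : ℝ) ≤ |(z i : ℝ)| := by exact_mod_cast Int.one_le_abs hi.1
  nlinarith [norm_nonneg (gsVec b i)]

/-- The first `p` vectors of a `δ`-LLL-reduced basis are not much longer than any `p` linearly
independent lattice vectors. -/
theorem IsLLLReducedBasis.norm_le {ι : Type*} [Fintype ι] {k m : ℕ} {δ : ℝ} {Λ : Lat m}
    {b : Fin k → Fin m → ℤ} (hb : IsLLLReducedBasis δ Λ b) (hδ : 1 / 4 < δ) (hδ1 : δ ≤ 1)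
    {t : ι → Fin m → ℤ} (ht : LinearIndependent ℤ t) (htΛ : ∀ l, t l ∈ Λ) {T : ℝ}
    (hT : ∀ l, ‖toEuclidean (t l)‖ ^ 2 ≤ T) (j : Fin k) (hj : (j : ℕ) < Fintype.card ι) :
    ‖toEuclidean (b j)‖ ^ 2 ≤ (δ - 1 / 4)⁻¹ ^ (k - 1) * T := by
  set c := (δ - 1 / 4)⁻¹ with hc
  have hc1 : 1 ≤ c := by
    rw [hc, le_inv_comm₀ (by norm_num) (by linarith)]
    linarith
  -- The span of the first `j` basis vectors has rank at most `j`, too small to contain all of the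
  -- more than `j` independent `t_l`.
  have hex : ∃ l, t l ∉ span ℤ (b '' {i | (i : ℕ) < j}) := by
    by_contra! hcon
    have h₁ := linearIndependent_le_span' t ht (b '' {i | (i : ℕ) < j})
      (Set.range_subset_iff.2 hcon)
    have h₂ : Fintype.card (b '' {i : Fin k | (i : ℕ) < j}) ≤ j := by
      rw [Fintype.card_eq_nat_card, Nat.card_coe_set_eq]
      refine (Set.ncard_image_le (Set.toFinite _)).trans ?_
      have : {i : Fin k | (i : ℕ) < j} = ((Finset.Iio j : Finset (Fin k)) : Set (Fin k)) := by
        ext i; simp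
      rw [this, Set.ncard_coe_finset, Fin.card_Iio]
    rw [Cardinal.mk_fintype] at h₁
    have h₃ : Fintype.card ι ≤ Fintype.card (b '' {i : Fin k | (i : ℕ) < j}) := by exact_mod_cast h₁
    omega
  obtain ⟨l, hl⟩ := hex
  obtain ⟨i, hji, hi⟩ := exists_norm_gsVec_le b (hb.isBasis.2 ▸ htΛ l) hl
  have h₁ := hb.norm_le_gsVec hδ hδ1 j
  have h₂ := hb.norm_gsVec_le hδ ((i : ℕ) - j) (i := j) (j := i) (by omega)
  have h₃ : ‖gsVec b i‖ ^ 2 ≤ T := (pow_le_pow_left₀ (norm_nonneg _) hi 2).trans (hT l)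
  have hc0 : 0 ≤ c := by linarith
  calc _ ≤ c ^ (j : ℕ) * ‖gsVec b j‖ ^ 2 := h₁
    _ ≤ c ^ (j : ℕ) * (c ^ ((i : ℕ) - j) * ‖gsVec b i‖ ^ 2) := by gcongr
    _ = c ^ (i : ℕ) * ‖gsVec b i‖ ^ 2 := by
        rw [← mul_assoc, ← pow_add, Nat.add_sub_cancel' hji]
    _ ≤ c ^ (k - 1) * T := by
        refine mul_le_mul (pow_le_pow_right₀ hc1 (by omega)) h₃ (sq_nonneg _) (pow_nonneg hc0 _)

end HiddenLattice

/-! ### Short vectors in the orthogonal lattice -/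

namespace HiddenLattice

open Submodule

/-- **Hadamard's inequality** for real square matrices. -/
theorem abs_det_le_prod_norm {n : ℕ} (A : Matrix (Fin n) (Fin n) ℝ) :
    |A.det| ≤ ∏ i, ‖WithLp.toLp 2 (A i)‖ := by
  let e := EuclideanSpace.basisFun (Fin n) ℝ
  have : Fact (Module.finrank ℝ (EuclideanSpace ℝ (Fin n)) = n) := ⟨by simp⟩
  have h := e.toBasis.orientation.abs_volumeForm_apply_le (fun i => WithLp.toLp 2 (A i))
  rw [e.toBasis.orientation.volumeForm_robust e rfl, Module.Basis.det_apply] at h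
  have hA : e.toBasis.toMatrix (fun i => WithLp.toLp 2 (A i)) = A.transpose := by
    ext i j
    simp [e, Module.Basis.toMatrix_apply]
  rwa [hA, Matrix.det_transpose] at h

/-- The generalized cross product of `n` vectors of `ℤ^(n+1)`. -/
def crossVec {n : ℕ} (A : Matrix (Fin n) (Fin (n + 1)) ℤ) (p : Fin (n + 1)) : ℤ :=
  (-1) ^ (p : ℕ) * (A.submatrix id p.succAbove).det

theorem dotProduct_crossVec {n : ℕ} (A : Matrix (Fin n) (Fin (n + 1)) ℤ) (r : Fin (n + 1) → ℤ) :
    r ⬝ᵥ crossVec A = (Matrix.of (Fin.cons r A : Fin (n + 1) → Fin (n + 1) → ℤ)).det := by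
  rw [Matrix.det_succ_row_zero, dotProduct]
  refine Finset.sum_congr rfl fun p _ => ?_
  have : (Matrix.of (Fin.cons r A : Fin (n + 1) → Fin (n + 1) → ℤ)).submatrix Fin.succ p.succAbove
      = A.submatrix id p.succAbove := by
    ext i j; rfl
  rw [this, crossVec, mul_comm, mul_right_comm]
  rfl

theorem row_dotProduct_crossVec {n : ℕ} (A : Matrix (Fin n) (Fin (n + 1)) ℤ) (i : Fin n) :
    A i ⬝ᵥ crossVec A = 0 := by
  rw [dotProduct_crossVec]
  refine Matrix.det_zero_of_row_eq (i := 0) (j := i.succ) (Fin.succ_ne_zero i).symm ?_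
  ext j; rfl

/-- With `y` the cross product, `‖y‖² = y ⬝ y` is the determinant with rows `y` and the `A_i`.
Hadamard bounds it by `‖y‖ ∏ ‖A_i‖`, and one factor `‖y‖` cancels. -/
theorem norm_crossVec_le {n : ℕ} (A : Matrix (Fin n) (Fin (n + 1)) ℤ) :
    ‖toEuclidean (crossVec A)‖ ≤ ∏ i, ‖toEuclidean (A i)‖ := by
  rcases eq_or_ne (toEuclidean (crossVec A)) 0 with h0 | h0
  · rw [h0, norm_zero]
    exact Finset.prod_nonneg fun i _ => norm_nonneg _
  have h₁ := norm_toEuclidean_sq (crossVec A)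
  rw [dotProduct_crossVec, ← eq_intCast (Int.castRingHom ℝ), RingHom.map_det] at h₁
  have h₂ := abs_det_le_prod_norm ((Int.castRingHom ℝ).mapMatrix
    (Matrix.of (Fin.cons (crossVec A) A : Fin (n + 1) → Fin (n + 1) → ℤ)))
  rw [← h₁, Fin.prod_univ_succ, abs_of_nonneg (sq_nonneg _), sq] at h₂
  exact le_of_mul_le_mul_left h₂ (norm_pos_iff.2 h0)

/-- An integral matrix with linearly independent rows has a nonzero maximal minor. -/
theorem exists_submatrix_det_ne_zero {n m : ℕ} {B : Fin n → Fin m → ℤ}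
    (hB : LinearIndependent ℤ B) :
    ∃ e : Fin n → Fin m, Function.Injective e ∧ ((Matrix.of B).submatrix id e).det ≠ 0 := by
  have hR := linearIndependent_toEuclidean_iff.2 hB
  let A : Matrix (Fin n) (Fin m) ℝ := (Matrix.of B).map (Int.castRingHom ℝ)
  have hA : LinearIndependent ℝ A.row := by
    have := hR.map' (WithLp.linearEquiv 2 ℝ (Fin m → ℝ)).toLinearMap (LinearEquiv.ker _)
    exact this
  have hrank : Module.finrank ℝ (span ℝ (Set.range A.col)) = n := by
    rw [← Matrix.rank_eq_finrank_span_cols, hA.rank_matrix, Fintype.card_fin]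
  obtain ⟨κ, a, ha, hspan, hli⟩ := exists_linearIndependent' ℝ A.col
  have : Finite κ := Finite.of_injective a ha
  have := Fintype.ofFinite κ
  have hcard : Fintype.card κ = n := by
    rw [linearIndependent_iff_card_eq_finrank_span.1 hli, Set.finrank, hspan, hrank]
  let f : Fin n ≃ κ := (Fintype.equivFinOfCardEq hcard).symm
  refine ⟨a ∘ f, ha.comp f.injective, fun h => ?_⟩
  have hli' : LinearIndependent ℝ (A.submatrix id (a ∘ f)).col := hli.comp f f.injective
  rw [Matrix.linearIndependent_cols_iff_isUnit, Matrix.isUnit_iff_isUnit_det] at hli'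
  refine hli'.ne_zero ?_
  have : A.submatrix id (a ∘ f) =
      (Int.castRingHom ℝ).mapMatrix ((Matrix.of B).submatrix id (a ∘ f)) := rfl
  rw [this, ← RingHom.map_det, h, map_zero]

theorem extend_dotProduct {ι : Type*} [Fintype ι] {m : ℕ} {e : ι → Fin m}
    (he : Function.Injective e) (y : ι → ℤ) (v : Fin m → ℤ) :
    Function.extend e y 0 ⬝ᵥ v = y ⬝ᵥ (v ∘ e) := by
  classical
  rw [dotProduct, dotProduct]
  have h : ∀ l ∈ Finset.univ, l ∉ Finset.univ.image e → Function.extend e y 0 l * v l = 0 := by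
    intro l _ hl
    rw [Function.extend_apply', Pi.zero_apply, zero_mul]
    rintro ⟨p, rfl⟩
    exact hl (Finset.mem_image_of_mem e (Finset.mem_univ p))
  rw [← Finset.sum_subset (Finset.subset_univ _) h, Finset.sum_image he.injOn]
  simp [he.extend_apply]

theorem mem_orth_span {m : ℕ} {s : Set (Fin m → ℤ)} {v : Fin m → ℤ} :
    v ∈ orth (span ℤ s) ↔ ∀ w ∈ s, v ⬝ᵥ w = 0 := by
  refine ⟨fun h w hw => h w (subset_span hw), fun h w hw => ?_⟩
  induction hw using Submodule.span_induction with
  | mem z hz => exact h z hz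
  | zero => simp
  | add a b _ _ ha hb => rw [dotProduct_add, ha, hb, add_zero]
  | smul c a _ ha => rw [dotProduct_smul, ha, smul_zero]

theorem mem_orth_hiddenLattice {n m : ℕ} {B : Fin n → Fin m → ℤ} {v : Fin m → ℤ} :
    v ∈ orth (hiddenLattice B) ↔ ∀ i, v ⬝ᵥ B i = 0 := by
  rw [hiddenLattice, mem_orth_span, Set.forall_mem_range]

theorem norm_comp_le {n m : ℕ} {e : Fin n → Fin m} (he : Function.Injective e) (v : Fin m → ℤ) :
    ‖toEuclidean (v ∘ e)‖ ≤ ‖toEuclidean v‖ := by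
  rw [← sq_le_sq₀ (norm_nonneg _) (norm_nonneg _), norm_toEuclidean_sq, norm_toEuclidean_sq,
    Int.cast_le, dotProduct, dotProduct]
  refine le_of_eq_of_le (Finset.sum_map Finset.univ ⟨e, he⟩ fun l => v l * v l).symm ?_
  exact Finset.sum_le_univ_sum_of_nonneg fun l => mul_self_nonneg _

/-- The orthogonal lattice of `n` independent vectors of `ℤ^m` contains `m - n` independent vectors
whose norms are at most the product of the norms of the given vectors. -/
theorem exists_short_vectors_orth {n m : ℕ} {B : Fin n → Fin m → ℤ}
    (hB : LinearIndependent ℤ B) :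
    ∃ (ι : Type) (_ : Fintype ι) (t : ι → Fin m → ℤ), Fintype.card ι = m - n ∧
      LinearIndependent ℤ t ∧ ∀ l, t l ∈ orth (hiddenLattice B) ∧
        ‖toEuclidean (t l)‖ ≤ ∏ i, ‖toEuclidean (B i)‖ := by
  classical
  obtain ⟨e, he, hdet⟩ := exists_submatrix_det_ne_zero hB
  -- For each column `j` outside a nonzero maximal minor, take the cross product on the columns `j`
  -- and `e`, and extend it by zero. Its entry at `j` is that minor and it vanishes at the other
  -- columns outside `e`, so these vectors are independent.
  let e' : Fin m → Fin (n + 1) → Fin m := fun j => Fin.cons j e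
  let y : Fin m → Fin (n + 1) → ℤ := fun j => crossVec ((Matrix.of B).submatrix id (e' j))
  have he' : ∀ j, j ∉ Set.range e → Function.Injective (e' j) := fun j hj =>
    Fin.cons_injective_iff.2 ⟨hj, he⟩
  have hy0 : ∀ j, y j 0 = ((Matrix.of B).submatrix id e).det := by
    intro j
    simp only [y, crossVec, Fin.val_zero, pow_zero, one_mul]
    congr 1
  refine ⟨{j : Fin m // j ∉ Set.range e}, inferInstance, fun j => Function.extend (e' j) (y j) 0,
    ?_, ?_, fun l => ⟨?_, ?_⟩⟩
  · have h := Fintype.card_subtype_compl (fun j : Fin m => j ∈ Set.range e)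
    rw [h, Fintype.card_fin]
    congr 1
    exact (Set.card_range_of_injective he).trans (Fintype.card_fin n)
  · rw [Fintype.linearIndependent_iff]
    intro z hz l
    have h := congrFun hz l.1
    rw [Finset.sum_apply, Finset.sum_eq_single l] at h
    · have hl : Function.extend (e' l.1) (y l.1) 0 l.1 = y l.1 0 :=
        (he' l.1 l.2).extend_apply _ _ 0
      rw [Pi.smul_apply, hl, hy0, Pi.zero_apply, smul_eq_mul, mul_eq_zero] at h
      exact h.resolve_right hdet
    · intro l' _ hl'
      rw [Pi.smul_apply, Function.extend_apply', Pi.zero_apply, smul_zero]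
      rintro ⟨p, hp⟩
      refine Fin.cases (fun h => ?_) (fun q h => ?_) p hp
      · exact hl' (Subtype.ext h)
      · exact l.2 ⟨q, h⟩
    · simp
  · rw [mem_orth_hiddenLattice]
    intro i
    rw [extend_dotProduct (he' l.1 l.2), dotProduct_comm]
    exact row_dotProduct_crossVec ((Matrix.of B).submatrix id (e' l.1)) i
  · have h₁ : ‖toEuclidean (Function.extend (e' l.1) (y l.1) 0)‖ = ‖toEuclidean (y l.1)‖ := by
      rw [← sq_eq_sq₀ (norm_nonneg _) (norm_nonneg _), norm_toEuclidean_sq, norm_toEuclidean_sq,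
        extend_dotProduct (he' l.1 l.2)]
      congr 2
      funext p
      exact (he' l.1 l.2).extend_apply _ _ _
    rw [h₁]
    refine (norm_crossVec_le _).trans (Finset.prod_le_prod (fun i _ => norm_nonneg _) fun i _ => ?_)
    exact norm_comp_le (he' l.1 l.2) (B i)

theorem sum_norm_sq_le {n m : ℕ} {B : Fin n → Fin m → ℤ} (hn : 0 < n) {μ : ℝ} (hμ : 0 ≤ μ)
    (hB : size B ≤ μ) : ∑ i, ‖toEuclidean (B i)‖ ^ 2 ≤ n * μ ^ 2 := by
  rw [size, Real.sqrt_le_left hμ, one_div, inv_mul_eq_div, div_le_iff₀ (by positivity)] at hB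
  linarith

/-- This is AM–GM applied to the squared norms. -/
theorem prod_norm_le {n m : ℕ} {B : Fin n → Fin m → ℤ} (hn : 0 < n) {μ : ℝ} (hμ : 0 ≤ μ)
    (hB : size B ≤ μ) : ∏ i, ‖toEuclidean (B i)‖ ≤ μ ^ n := by
  have hn' : (n : ℝ) ≠ 0 := by positivity
  have h := Real.geom_mean_le_arith_mean_weighted Finset.univ (fun _ : Fin n => (1 / n : ℝ))
    (fun i => ‖toEuclidean (B i)‖ ^ 2) (fun _ _ => by positivity) (by simp [hn'])
    (fun _ _ => sq_nonneg _)
  have h₂ : ∑ i, (1 / n : ℝ) * ‖toEuclidean (B i)‖ ^ 2 ≤ μ ^ 2 := by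
    rw [← Finset.mul_sum, one_div, inv_mul_le_iff₀ (by positivity)]
    exact sum_norm_sq_le hn hμ hB
  rw [Real.finsetProd_rpow _ _ (fun _ _ => sq_nonneg _)] at h
  have hP : 0 ≤ ∏ i, ‖toEuclidean (B i)‖ ^ 2 := Finset.prod_nonneg fun _ _ => sq_nonneg _
  have h₃ := pow_le_pow_left₀ (Real.rpow_nonneg hP _) (h.trans h₂) n
  rw [one_div, Real.rpow_inv_natCast_pow hP hn.ne', Finset.prod_pow, ← pow_mul, mul_comm 2 n,
    pow_mul] at h₃
  exact (sq_le_sq₀ (Finset.prod_nonneg fun _ _ => norm_nonneg _) (by positivity)).1 h₃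

end HiddenLattice

/-! ### Counting coefficient vectors with small relations modulo `N` -/

namespace HiddenLattice

/-- For a primitive vector `q`, the congruence `d ⟨a, q⟩ ≡ 0 (mod N)` has at most `d N^(n-1)`
solutions `a`. -/
theorem card_solutions_mul_le {n N : ℕ} [NeZero N] {q : Fin n → ℤ} (hq : Finset.univ.gcd q = 1)
    {d : ℕ} (hd : 0 < d) :
    {a : Fin n → ZMod N | (d : ZMod N) * ∑ i, a i * (q i : ZMod N) = 0}.ncard * N ≤ d * N ^ n := by
  let ψ : (Fin n → ZMod N) →+ ZMod N :=
    { toFun := fun a => (d : ZMod N) * ∑ i, a i * (q i : ZMod N)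
      map_zero' := by simp
      map_add' := fun a b => by simp [add_mul, Finset.sum_add_distrib, mul_add] }
  have hker : {a : Fin n → ZMod N | (d : ZMod N) * ∑ i, a i * (q i : ZMod N) = 0}.ncard =
      Nat.card ψ.ker := rfl
  have hmul : Nat.card ψ.ker * Nat.card ψ.range = N ^ n := by
    rw [← AddSubgroup.index_ker, AddSubgroup.card_mul_index]
    simp
  -- By Bézout the primitive form `⟨a, q⟩` takes the value 1, so `d` itself is a value of `ψ`.
  have hd_mem : (d : ZMod N) ∈ ψ.range := by
    obtain ⟨f, hf⟩ := Finset.gcd_eq_sum_mul Finset.univ q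
    refine ⟨fun i => (f i : ZMod N), ?_⟩
    have h : ∑ i, (f i : ZMod N) * (q i : ZMod N) = 1 := by
      rw [hq] at hf
      have := congrArg (Int.cast : ℤ → ZMod N) hf
      push_cast at this
      rw [this]
      exact Finset.sum_congr rfl fun i _ => by ring
    simp [ψ, h]
  -- The order of `d` in `ℤ/Nℤ` is at least `N / d`, so the image of `ψ` has at least that many
  -- elements.
  have hrange : N ≤ Nat.card ψ.range * d := by
    have h₁ : addOrderOf (d : ZMod N) ≤ Nat.card ψ.range := by
      rw [← Nat.card_zmultiples]
      exact AddSubgroup.card_le_of_le (AddSubgroup.zmultiples_le_of_mem hd_mem)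
    have h₂ : N ∣ addOrderOf (d : ZMod N) * d := by
      rw [← ZMod.natCast_eq_zero_iff]
      have := addOrderOf_nsmul_eq_zero (d : ZMod N)
      rw [nsmul_eq_mul] at this
      exact_mod_cast this
    have h₃ : 0 < addOrderOf (d : ZMod N) := addOrderOf_pos _
    exact (Nat.le_of_dvd (by positivity) h₂).trans (Nat.mul_le_mul_right d h₁)
  rw [hker]
  calc Nat.card ψ.ker * N ≤ Nat.card ψ.ker * (Nat.card ψ.range * d) := Nat.mul_le_mul_left _ hrange
    _ = d * N ^ n := by rw [← mul_assoc, hmul, mul_comm]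

/-- The coefficient vectors that satisfy a nontrivial relation modulo `N` with integral
coefficients of absolute value at most `R`. -/
def relatedVectors (n N : ℕ) (R : ℝ) : Set (Fin n → ZMod N) :=
  {a | ∃ q : Fin n → ℤ, q ≠ 0 ∧ (∀ i, |(q i : ℝ)| ≤ R) ∧ ∑ i, a i * (q i : ZMod N) = 0}

/-- The integral vectors with entries of absolute value at most `r`. -/
noncomputable def box (n : ℕ) (r : ℝ) : Finset (Fin n → ℤ) :=
  Fintype.piFinset fun _ => Finset.Icc (-⌊r⌋) ⌊r⌋

theorem card_box_le (n : ℕ) {r : ℝ} (hr : 0 ≤ r) : ((box n r).card : ℝ) ≤ (2 * r + 1) ^ n := by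
  rw [box, Fintype.card_piFinset, Finset.prod_const, Finset.card_univ, Fintype.card_fin,
    Int.card_Icc, Nat.cast_pow]
  refine pow_le_pow_left₀ (Nat.cast_nonneg _) ?_ n
  have h₀ : 0 ≤ ⌊r⌋ := Int.floor_nonneg.2 hr
  have h₁ : (((⌊r⌋ + 1 - -⌊r⌋).toNat : ℤ) : ℝ) = 2 * ⌊r⌋ + 1 := by
    rw [Int.toNat_of_nonneg (by omega)]
    push_cast
    ring
  rw [Int.cast_natCast] at h₁
  rw [h₁]
  linarith [Int.floor_le r]

/-- Here `d` is the content of the relation and `q` its primitive part. A primitive vector has a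
nonzero integral entry, which forces `d ≤ R`. -/
theorem relatedVectors_subset {n N : ℕ} (R : ℝ) :
    relatedVectors n N R ⊆ ⋃ d ∈ Finset.Icc 1 ⌊R⌋₊, ⋃ q ∈ (box n (R / d)).filter
      (fun q => Finset.univ.gcd q = 1),
        {a : Fin n → ZMod N | (d : ZMod N) * ∑ i, a i * (q i : ZMod N) = 0} := by
  rintro a ⟨q, hq0, hqR, hqa⟩
  obtain ⟨i₀, hi₀⟩ := Function.ne_iff.1 hq0
  obtain ⟨q', hq', hgcd⟩ := Finset.extract_gcd q (s := Finset.univ) ⟨i₀, Finset.mem_univ _⟩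
  set g : ℤ := Finset.univ.gcd q with hg
  have hg0 : 0 ≤ g := Int.nonneg_of_normalize_eq_self Finset.normalize_gcd
  obtain ⟨d, hd⟩ := Int.eq_ofNat_of_zero_le hg0
  rw [hd] at hq'
  have habs : ∀ i, |(q i : ℝ)| = d * |(q' i : ℝ)| := fun i => by
    rw [hq' i (Finset.mem_univ i)]
    push_cast
    rw [abs_mul, Nat.abs_cast]
  have hi₀' := hq' i₀ (Finset.mem_univ _)
  have hd0 : 0 < d := by
    rcases Nat.eq_zero_or_pos d with rfl | h
    · simp only [Nat.cast_zero, zero_mul] at hi₀'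
      exact absurd hi₀' hi₀
    · exact h
  have hdR : (d : ℝ) ≤ R := by
    have h₁ : q' i₀ ≠ 0 := fun h => hi₀ (by rw [hi₀', h, mul_zero]; rfl)
    have h₂ : (1 : ℝ) ≤ |(q' i₀ : ℝ)| := by exact_mod_cast Int.one_le_abs h₁
    have h₃ := hqR i₀
    rw [habs] at h₃
    exact (le_mul_of_one_le_right (Nat.cast_nonneg d) h₂).trans h₃
  simp only [Set.mem_iUnion]
  refine ⟨d, Finset.mem_Icc.2 ⟨hd0, Nat.le_floor hdR⟩, q', Finset.mem_filter.2 ⟨?_, hgcd⟩, ?_⟩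
  · rw [box, Fintype.mem_piFinset]
    intro i
    have h₁ : |(q' i : ℝ)| ≤ R / d := by
      rw [le_div_iff₀ (by positivity), mul_comm, ← habs]
      exact hqR i
    have h₂ := abs_le.1 h₁
    rw [Finset.mem_Icc, neg_le, Int.le_floor, Int.le_floor]
    push_cast
    exact ⟨by linarith, h₂.2⟩
  · rw [Set.mem_ofPred_eq, ← hqa, Finset.mul_sum]
    refine Finset.sum_congr rfl fun i hi => ?_
    rw [hq' i hi]
    push_cast
    ring

theorem card_relatedVectors_mul_le {n N : ℕ} [NeZero N] {R : ℝ} (hR : 0 ≤ R) :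
    ((relatedVectors n N R).ncard : ℝ) * N ≤
      (N : ℝ) ^ n * ∑ d ∈ Finset.Icc 1 ⌊R⌋₊, (d : ℝ) * (2 * (R / d) + 1) ^ n := by
  have h₁ : (relatedVectors n N R).ncard ≤ ∑ d ∈ Finset.Icc 1 ⌊R⌋₊,
      ∑ q ∈ (box n (R / d)).filter (fun q => Finset.univ.gcd q = 1),
        {a : Fin n → ZMod N | (d : ZMod N) * ∑ i, a i * (q i : ZMod N) = 0}.ncard := by
    refine (Set.ncard_le_ncard (relatedVectors_subset R) (Set.toFinite _)).trans ?_
    refine (Finset.set_ncard_biUnion_le _ _).trans (Finset.sum_le_sum fun d _ => ?_)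
    exact Finset.set_ncard_biUnion_le _ _
  have h₂ : (relatedVectors n N R).ncard * N ≤ ∑ d ∈ Finset.Icc 1 ⌊R⌋₊,
      (box n (R / d)).card * (d * N ^ n) := by
    refine (Nat.mul_le_mul_right N h₁).trans ?_
    rw [Finset.sum_mul]
    refine Finset.sum_le_sum fun d hd => ?_
    rw [Finset.sum_mul]
    refine (Finset.sum_le_card_nsmul _ _ (d * N ^ n) fun q hq => ?_).trans ?_
    · exact card_solutions_mul_le (Finset.mem_filter.1 hq).2 (Finset.mem_Icc.1 hd).1
    · rw [smul_eq_mul]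
      exact Nat.mul_le_mul_right _ (Finset.card_filter_le _ _)
  calc ((relatedVectors n N R).ncard : ℝ) * N
      ≤ ∑ d ∈ Finset.Icc 1 ⌊R⌋₊, ((box n (R / d)).card : ℝ) * (d * N ^ n) := by exact_mod_cast h₂
    _ ≤ ∑ d ∈ Finset.Icc 1 ⌊R⌋₊, (2 * (R / d) + 1) ^ n * ((d : ℝ) * N ^ n) := by
        gcongr with d _
        exact card_box_le n (by positivity)
    _ = _ := by
        rw [Finset.mul_sum]
        exact Finset.sum_congr rfl fun d _ => by ring

theorem sum_mul_pow_le {n : ℕ} (hn : 3 ≤ n) {R : ℝ} (hR : 3 / 2 ≤ R) :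
    ∑ d ∈ Finset.Icc 1 ⌊R⌋₊, (d : ℝ) * (2 * (R / d) + 1) ^ n ≤
      Real.exp 1 * (Real.sqrt 8 * R) ^ n := by
  set s := Real.sqrt 8 with hs
  have hs2 : s ^ 2 = 8 := Real.sq_sqrt (by norm_num)
  -- The rational lower bound for `√8` is chosen so that `27 / (8 · 45/16) = 6/5`, the constant in
  -- `h₂`.
  have hs1 : 45 / 16 ≤ s := Real.le_sqrt_of_sq_le (by norm_num)
  set S := (s * R) ^ n with hS
  have hS0 : 0 ≤ S := by positivity
  have h₁ : (2 * R + 1) ^ n ≤ S := by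
    refine pow_le_pow_left₀ (by linarith) ?_ n
    nlinarith
  -- For the term of index `x = d + 1 ≤ R`, `2R/x + 1 ≤ 3R/x = √8 R · 3/(√8 x)`. The last factor is
  -- at most 1, so its `n`-th power is at most its cube. This leaves a multiple of `1/x²`, which
  -- telescopes.
  have h₂ : ∀ d : ℕ, 1 ≤ d → ((d + 1 : ℕ) : ℝ) ≤ R →
      ((d + 1 : ℕ) : ℝ) * (2 * (R / ((d + 1 : ℕ) : ℝ)) + 1) ^ n ≤
        6 / 5 * S * (1 / d - 1 / (d + 1 : ℕ)) := by
    intro d hd hdR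
    have hd1 : (1 : ℝ) ≤ d := by exact_mod_cast hd
    push_cast at hdR ⊢
    set x : ℝ := (d : ℝ) + 1 with hx
    have hx0 : 2 ≤ x := by linarith
    have h3 : 2 * (R / x) + 1 ≤ s * R * (3 / (s * x)) := by
      have h4 : 1 ≤ R / x := by rw [le_div_iff₀ (by linarith)]; linarith
      have h5 : s * R * (3 / (s * x)) = 3 * (R / x) := by
        field_simp
      linarith
    have h6 : (3 / (s * x)) ^ n ≤ (3 / (s * x)) ^ 3 := by
      refine pow_le_pow_of_le_one (by positivity) ?_ hn
      rw [div_le_one (by positivity)]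
      nlinarith
    have h7 : (3 / (s * x)) ^ 3 ≤ 6 / 5 / x ^ 3 := by
      rw [div_pow, div_le_div_iff₀ (by positivity) (by positivity), mul_pow]
      have : s ^ 3 = 8 * s := by rw [pow_succ, hs2]
      rw [this]
      have hx3 : 0 ≤ x ^ 3 := by positivity
      nlinarith
    have h8 : 1 / x ^ 2 ≤ 1 / (d : ℝ) - 1 / x := by
      rw [div_sub_div _ _ (by linarith) (by linarith), div_le_div_iff₀ (by positivity)
        (by positivity)]
      rw [hx]
      ring_nf
      nlinarith
    calc x * (2 * (R / x) + 1) ^ n ≤ x * (s * R * (3 / (s * x))) ^ n := by gcongr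
      _ = x * (S * (3 / (s * x)) ^ n) := by rw [mul_pow]
      _ ≤ x * (S * (6 / 5 / x ^ 3)) := by gcongr; exact h6.trans h7
      _ = 6 / 5 * S * (1 / x ^ 2) := by field_simp
      _ ≤ _ := by gcongr
  have h₃ : ∀ D : ℕ, 1 ≤ D → (D : ℝ) ≤ R →
      ∑ d ∈ Finset.Icc 1 D, (d : ℝ) * (2 * (R / d) + 1) ^ n ≤ S + 6 / 5 * S * (1 - 1 / D) := by
    intro D hD
    induction D, hD using Nat.le_induction with
    | base => intro _; simpa using h₁
    | succ D hD ih =>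
      intro hDR
      rw [Finset.sum_Icc_succ_top (by omega)]
      have := ih (by push_cast at hDR; linarith)
      have := h₂ D hD hDR
      linarith
  have hfl : 1 ≤ ⌊R⌋₊ := Nat.le_floor (by norm_num; linarith)
  refine (h₃ _ hfl (Nat.floor_le (by linarith))).trans ?_
  -- The total is at most `(1 + 6/5) S`, and `11/5 < e`.
  have he := Real.exp_one_gt_d9
  have : 0 ≤ 1 / (⌊R⌋₊ : ℝ) := by positivity
  nlinarith

/-- The radius up to which relations modulo `N` have to be excluded. -/
noncomputable def relationRadius (n m : ℕ) (c μ : ℝ) : ℝ :=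
  Real.sqrt n * Real.sqrt (c ^ (m - 1)) * μ ^ (n + 1)

/-- After taking logarithms and dividing by `n/2`, the spare terms of the hypothesis are `log c ≥
log (4/3)`, `(m-n) log (2(m-n)/3) ≥ log (2/3)` and `2 log 3`. They cover `log 8` exactly, since `4/3
· 2/3 · 9 = 8`. -/
theorem exp_mul_relationRadius_lt {n m N : ℕ} (hn : 3 ≤ n) (hnm : n < m) (hN : 0 < N)
    {μ c ε : ℝ} (hμ : 1 ≤ μ) (hc : 4 / 3 ≤ c) (hε : 0 < ε)
    (hlog : Real.log ((N : ℝ) * ε) >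
      (m : ℝ) * n / 2 * Real.log c + (n : ℝ) * (n + 1) * Real.log μ
        + (n : ℝ) * ((m : ℝ) - n) / 2 * Real.log (2 / 3 * ((m : ℝ) - n))
        + (n : ℝ) * Real.log (3 * Real.sqrt n) + 1) :
    Real.exp 1 * (Real.sqrt 8 * relationRadius n m c μ) ^ n < N * ε := by
  have hn0 : (0 : ℝ) < n := by positivity
  have hN0 : (0 : ℝ) < N := by positivity
  have hc0 : 0 < c := by linarith
  rw [← Real.log_lt_log_iff (by rw [relationRadius]; positivity) (by positivity)]
  refine lt_of_le_of_lt ?_ hlog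
  have hk : Real.log (2 / 3) ≤ ((m : ℝ) - n) * Real.log (2 / 3 * ((m : ℝ) - n)) := by
    rcases Nat.lt_or_ge m (n + 2) with h | h
    · have : m = n + 1 := by omega
      subst this
      simp
    · have h2 : (n : ℝ) + 2 ≤ m := by exact_mod_cast h
      have h3 : Real.log (2 / 3 : ℝ) ≤ 0 := Real.log_nonpos (by norm_num) (by norm_num)
      exact h3.trans (mul_nonneg (by linarith) (Real.log_nonneg (by linarith)))
  have hc' : Real.log (4 / 3) ≤ Real.log c := Real.log_le_log (by norm_num) hc
  have hsum : Real.log (4 / 3) + Real.log (2 / 3) + 2 * Real.log 3 - Real.log 8 = 0 := by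
    have h9 : 2 * Real.log 3 = Real.log (3 ^ 2) := by rw [Real.log_pow]; norm_num
    rw [h9, ← Real.log_mul (by norm_num) (by norm_num),
      ← Real.log_mul (by norm_num) (by norm_num), ← Real.log_div (by norm_num) (by norm_num)]
    norm_num
  have hm : ((m - 1 : ℕ) : ℝ) = m - 1 := by
    rw [Nat.cast_sub (by omega), Nat.cast_one]
  have hlogl : Real.log (Real.exp 1 * (Real.sqrt 8 * relationRadius n m c μ) ^ n) =
      1 + n * (Real.log 8 / 2 + (Real.log n / 2 + (m - 1) * Real.log c / 2 +
        (n + 1) * Real.log μ)) := by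
    rw [relationRadius, Real.log_mul (by positivity) (by positivity), Real.log_exp, Real.log_pow,
      Real.log_mul (by positivity) (by positivity), Real.log_mul (by positivity) (by positivity),
      Real.log_mul (by positivity) (by positivity), Real.log_sqrt (by positivity),
      Real.log_sqrt (by positivity), Real.log_sqrt (by positivity), Real.log_pow, Real.log_pow, hm]
    push_cast
    ring
  have hlogr : Real.log (3 * Real.sqrt n) = Real.log 3 + Real.log n / 2 := by
    rw [Real.log_mul (by norm_num) (by positivity), Real.log_sqrt (by positivity)]
  rw [hlogl, hlogr]
  have := mul_le_mul_of_nonneg_left hk hn0.le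
  have := mul_le_mul_of_nonneg_left hc' hn0.le
  have hs := congrArg (fun x => (n : ℝ) * x) hsum
  linarith

end HiddenLattice

/-! ### Orthogonal lattices, completions and success of the algorithm -/

namespace HiddenLattice

open Submodule

theorem linearIndependent_toRat_iff {ι : Type*} {m : ℕ} {b : ι → Fin m → ℤ} :
    LinearIndependent ℚ (fun i => toRat m (b i)) ↔ LinearIndependent ℤ b := by
  rw [← LinearIndependent.iff_fractionRing ℤ ℚ]
  refine LinearMap.linearIndependent_iff (toRat m) (LinearMap.ker_eq_bot.2 ?_)
  intro v w h
  ext i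
  have := congrFun h i
  simpa [toRat] using this

theorem mem_completion_hiddenLattice {n m : ℕ} {B : Fin n → Fin m → ℤ} {w : Fin m → ℤ} :
    w ∈ completion (hiddenLattice B) ↔
      toRat m w ∈ span ℚ (Set.range fun i => toRat m (B i)) := by
  have h : span ℚ (toRat m '' (hiddenLattice B : Set (Fin m → ℤ))) =
      span ℚ (Set.range fun i => toRat m (B i)) := by
    rw [← map_coe, hiddenLattice, map_span, span_span_of_tower, ← Set.range_comp]
    rfl
  rw [← h]
  rfl

/-- A lattice vector in the real span of `B` lies in the completion of the lattice of `B`. -/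
theorem mem_completion_of_mem_span {n m : ℕ} {B : Fin n → Fin m → ℤ} (hB : LinearIndependent ℤ B)
    {w : Fin m → ℤ} (hw : toEuclidean w ∈ span ℝ (Set.range fun i => toEuclidean (B i))) :
    w ∈ completion (hiddenLattice B) := by
  rw [mem_completion_hiddenLattice]
  by_contra hcon
  -- Linear independence of integral vectors is the same over `ℚ`, `ℤ` and `ℝ`; if `w` were outside
  -- the rational span, it would also be outside the real span.
  have h₁ : LinearIndependent ℚ (Fin.cons (toRat m w) fun i => toRat m (B i) :
      Fin (n + 1) → Fin m → ℚ) :=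
    linearIndependent_finCons.2 ⟨linearIndependent_toRat_iff.2 hB, hcon⟩
  have h₂ : (Fin.cons (toRat m w) fun i => toRat m (B i) : Fin (n + 1) → Fin m → ℚ) =
      fun j => toRat m ((Fin.cons w B : Fin (n + 1) → Fin m → ℤ) j) := by
    funext j; refine Fin.cases rfl (fun i => rfl) j
  rw [h₂, linearIndependent_toRat_iff, ← linearIndependent_toEuclidean_iff] at h₁
  have h₃ : (fun j => toEuclidean ((Fin.cons w B : Fin (n + 1) → Fin m → ℤ) j)) =
      (Fin.cons (toEuclidean w) fun i => toEuclidean (B i) :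
        Fin (n + 1) → EuclideanSpace ℝ (Fin m)) := by
    funext j; refine Fin.cases rfl (fun i => rfl) j
  rw [h₃, linearIndependent_finCons] at h₁
  exact h₁.2 hw

/-- The orthogonal lattice of `m - n` independent vectors orthogonal to `B` is the completion of
the lattice of `B`. -/
theorem orth_span_eq_completion {ι : Type*} [Fintype ι] {n m : ℕ} {B : Fin n → Fin m → ℤ}
    (hB : LinearIndependent ℤ B) {s : ι → Fin m → ℤ} (hs : LinearIndependent ℤ s)
    (hcard : Fintype.card ι + n = m) (hsB : ∀ l, s l ∈ orth (hiddenLattice B)) :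
    orth (span ℤ (Set.range s)) = completion (hiddenLattice B) := by
  apply le_antisymm
  · intro w hw
    rw [mem_orth_span, Set.forall_mem_range] at hw
    refine mem_completion_of_mem_span hB ?_
    let V := span ℝ (Set.range fun l => toEuclidean (s l))
    have hV : ∀ v : Fin m → ℤ, (∀ l, v ⬝ᵥ s l = 0) → toEuclidean v ∈ Vᗮ := by
      intro v hv
      rw [mem_orthogonal']
      intro x hx
      refine InnerProductSpace.inner_eq_zero_of_mem_span hx ?_
      rintro _ ⟨l, rfl⟩
      rw [inner_toEuclidean, hv l, Int.cast_zero]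
    -- The orthogonal complement of the span of the `s_l` has dimension `m - (m - n) = n`, so it
    -- equals the span of `B`, which it contains.
    have hle : span ℝ (Set.range fun i => toEuclidean (B i)) ≤ Vᗮ := by
      rw [span_le]
      rintro _ ⟨i, rfl⟩
      refine hV _ fun l => ?_
      rw [dotProduct_comm]
      exact mem_orth_hiddenLattice.1 (hsB l) i
    have hdim : Module.finrank ℝ V + Module.finrank ℝ Vᗮ = m := by
      rw [finrank_add_finrank_orthogonal, finrank_euclideanSpace_fin]
    have hdV : Module.finrank ℝ V = Fintype.card ι :=
      (linearIndependent_iff_card_eq_finrank_span.1 (linearIndependent_toEuclidean_iff.2 hs)).symm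
    have hdB : Module.finrank ℝ (span ℝ (Set.range fun i => toEuclidean (B i))) = n := by
      have := linearIndependent_iff_card_eq_finrank_span.1 (linearIndependent_toEuclidean_iff.2 hB)
      rw [Fintype.card_fin] at this
      exact this.symm
    rw [eq_of_le_of_finrank_eq hle (by omega)]
    exact hV w hw
  · intro w hw
    rw [mem_completion_hiddenLattice] at hw
    rw [mem_orth_span, Set.forall_mem_range]
    intro l
    have hcast : ∀ v : Fin m → ℤ, ((v ⬝ᵥ s l : ℤ) : ℚ) = toRat m v ⬝ᵥ toRat m (s l) := fun v => by
      simp [dotProduct, toRat]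
    have h : ∀ x ∈ span ℚ (Set.range fun i => toRat m (B i)), x ⬝ᵥ toRat m (s l) = 0 := by
      intro x hx
      induction hx using Submodule.span_induction with
      | mem z hz =>
        obtain ⟨i, rfl⟩ := hz
        rw [← hcast, dotProduct_comm, mem_orth_hiddenLattice.1 (hsB l) i, Int.cast_zero]
      | zero => simp
      | add a b _ _ ha hb => rw [add_dotProduct, ha, hb, add_zero]
      | smul c a _ ha => rw [smul_dotProduct, ha, smul_zero]
    have := h _ hw
    rw [← hcast] at this
    exact_mod_cast this

theorem card_le_of_linearIndependent_of_mem_span {R M : Type*} [Ring R] [Nontrivial R]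
    [StrongRankCondition R] [AddCommGroup M] [Module R M] {r n : ℕ} {v : Fin r → M} {w : Fin n → M}
    (hv : LinearIndependent R v) (h : ∀ i, v i ∈ span R (Set.range w)) : r ≤ n := by
  classical
  have h₁ := linearIndependent_le_span' v hv (Set.range w) (Set.range_subset_iff.2 h)
  rw [Cardinal.mk_fintype, Fintype.card_fin] at h₁
  have h₂ : r ≤ Fintype.card (Set.range w) := by exact_mod_cast h₁
  exact h₂.trans ((Fintype.card_range_le w).trans (Fintype.card_fin n).le)

theorem exists_isLatticeBasis {m r : ℕ} (Λ : Lat m) (hr : Module.finrank ℤ Λ = r) :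
    ∃ b : Fin r → Fin m → ℤ, IsLatticeBasis Λ b := by
  let b := Module.finBasisOfFinrankEq ℤ Λ hr
  refine ⟨fun i => b i, ?_, ?_⟩
  · exact b.linearIndependent.map' Λ.subtype (ker_subtype Λ)
  · have : (Set.range fun i => (b i : Fin m → ℤ)) = Λ.subtype '' Set.range b := by
      rw [← Set.range_comp]; rfl
    rw [this, ← map_span, b.span_eq, Submodule.map_top, range_subtype]

theorem exists_isLatticeBasis_completion {n m : ℕ} {B : Fin n → Fin m → ℤ}
    (hB : LinearIndependent ℤ B) :
    ∃ w : Fin n → Fin m → ℤ, IsLatticeBasis (completion (hiddenLattice B)) w := by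
  obtain ⟨b, hb⟩ := exists_isLatticeBasis (completion (hiddenLattice B)) rfl
  have h₁ := card_le_of_linearIndependent_of_mem_span (linearIndependent_toRat_iff.2 hb.1)
    (w := fun i => toRat m (B i)) fun i => mem_completion_hiddenLattice.1
      (hb.2 ▸ subset_span ⟨i, rfl⟩)
  have h₂ := card_le_of_linearIndependent_of_mem_span hB (w := b) fun i => by
    rw [hb.2, mem_completion_hiddenLattice]
    exact subset_span ⟨i, rfl⟩
  exact exists_isLatticeBasis _ (le_antisymm h₁ h₂)

theorem intCast_dotProduct {N m : ℕ} (u w : Fin m → ℤ) :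
    ((u ⬝ᵥ w : ℤ) : ZMod N) = ∑ j, (u j : ZMod N) * reduce N m w j := by
  simp [dotProduct, reduce]

/-- It is enough to test a single integral lift of `x`: the divisibility depends only on the
reduction of `w`, which is a multiple of `x`. -/
theorem mem_orthMod_publicLattice {N m : ℕ} {x : Fin m → ZMod N} {u : Fin m → ℤ} :
    u ∈ orthMod (publicLattice x) ↔ ∑ j, (u j : ZMod N) * x j = 0 := by
  constructor
  · intro h
    have hw : reduce N m (fun j => ((x j).cast : ℤ)) = x := by
      ext j
      simp [reduce]
    have := h (fun j => ((x j).cast : ℤ)) (by rw [hw]; exact subset_span rfl)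
    rwa [← ZMod.intCast_zmod_eq_zero_iff_dvd, intCast_dotProduct, hw] at this
  · intro h w hw
    obtain ⟨z, hz⟩ := mem_span_singleton.1 hw
    rw [← ZMod.intCast_zmod_eq_zero_iff_dvd, intCast_dotProduct, ← hz]
    simp only [Pi.smul_apply, mul_smul_comm]
    rw [← Finset.smul_sum, h, smul_zero]

theorem sum_mul_F {n m N : ℕ} (B : Fin n → Fin m → ℤ) (a : Fin n → ZMod N) (u : Fin m → ℤ) :
    ∑ j, (u j : ZMod N) * F N B a j = ∑ i, a i * ((u ⬝ᵥ B i : ℤ) : ZMod N) := by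
  simp only [F, Finset.sum_apply, Pi.smul_apply, smul_eq_mul, intCast_dotProduct, Finset.mul_sum]
  rw [Finset.sum_comm]
  exact Finset.sum_congr rfl fun i _ => Finset.sum_congr rfl fun j _ => by ring

theorem exists_isLatticeBasis_orthMod {N m : ℕ} (hN : 0 < N) (x : Fin m → ZMod N) :
    ∃ b : Fin m → Fin m → ℤ, IsLatticeBasis (orthMod (publicLattice x)) b := by
  obtain ⟨b, hb⟩ := exists_isLatticeBasis (orthMod (publicLattice x)) rfl
  refine exists_isLatticeBasis _ (le_antisymm ?_ ?_)
  · refine card_le_of_linearIndependent_of_mem_span hb.1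
      (w := fun i => (Pi.basisFun ℤ (Fin m)) i) fun i => ?_
    rw [(Pi.basisFun ℤ (Fin m)).span_eq]
    trivial
  -- The vectors `N e_i` all lie in the lattice, so it has full rank.
  · refine card_le_of_linearIndependent_of_mem_span (R := ℤ)
      (v := fun i : Fin m => (N : ℤ) • Pi.single i (1 : ℤ)) (w := b) ?_ fun i => ?_
    · rw [Fintype.linearIndependent_iff]
      intro g hg i
      have := congrFun hg i
      simp [Finset.sum_apply, Pi.single_apply] at this
      omega
    · rw [hb.2, mem_orthMod_publicLattice]
      simp

/-- Divide an integral relation by its content. Modulo `N` it becomes a relation with zero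
coefficients, so `N` divides the gcd 1. For `N = 1` this is no contradiction, hence `1 < N`. -/
theorem linearIndependent_of_reduce {n m N : ℕ} (hN : 1 < N) {B : Fin n → Fin m → ℤ}
    (hB : LinearIndependent (ZMod N) fun i => reduce N m (B i)) : LinearIndependent ℤ B := by
  rw [Fintype.linearIndependent_iff]
  intro z hz
  by_contra! hcon
  obtain ⟨i₀, hi₀⟩ := hcon
  obtain ⟨z', hz', hgcd⟩ := Finset.extract_gcd z (s := Finset.univ) ⟨i₀, Finset.mem_univ _⟩
  have hg : Finset.univ.gcd z ≠ 0 := fun h => hi₀ (by rw [hz' i₀ (Finset.mem_univ _), h, zero_mul])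
  have h₁ : ∑ i, z' i • B i = 0 := by
    refine (smul_eq_zero.1 ?_).resolve_left hg
    rw [← hz, Finset.smul_sum]
    exact Finset.sum_congr rfl fun i hi => by rw [smul_smul, ← hz' i hi]
  have h₂ : ∑ i, (z' i : ZMod N) • reduce N m (B i) = 0 := by
    rw [← map_zero (reduce N m), ← h₁, map_sum]
    exact Finset.sum_congr rfl fun i _ => by rw [map_smul, Int.cast_smul_eq_zsmul]
  have h₃ : (N : ℤ) ∣ Finset.univ.gcd z' := Finset.dvd_gcd fun i _ =>
    (ZMod.intCast_zmod_eq_zero_iff_dvd _ _).1 (Fintype.linearIndependent_iff.1 hB _ h₂ i)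
  rw [hgcd] at h₃
  have := Int.le_of_dvd one_pos h₃
  omega

theorem F_injective {n m N : ℕ} {B : Fin n → Fin m → ℤ}
    (hB : LinearIndependent (ZMod N) fun i => reduce N m (B i)) : Function.Injective (F N B) := by
  intro a a' h
  have h₁ : ∑ i, (a - a') i • reduce N m (B i) = 0 := by
    simp only [Pi.sub_apply, sub_smul, Finset.sum_sub_distrib]
    exact sub_eq_zero.2 h
  exact sub_eq_zero.1 (funext (Fintype.linearIndependent_iff.1 hB _ h₁))

/-- After ordering by norm, the first `p` vectors are no longer than the longest of the first `p`
vectors in the original order. -/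
theorem OrdersByNorm.norm_le {k m : ℕ} {u : Fin k → Fin m → ℤ} {τ : Equiv.Perm (Fin k)}
    (hτ : OrdersByNorm u τ) {p : ℕ} {T : ℝ}
    (h : ∀ j : Fin k, (j : ℕ) < p → ‖toEuclidean (u j)‖ ^ 2 ≤ T) (i : Fin k) (hi : (i : ℕ) < p) :
    ‖toEuclidean (u (τ i))‖ ^ 2 ≤ T := by
  -- Pigeonhole: the `i + 1` vectors of index at most `i` cannot all occupy positions before `i` in
  -- the sorted order. One that does not is at least as long as `u (τ i)`.
  obtain ⟨j, hj, hij⟩ : ∃ j ≤ i, i ≤ τ.symm j := by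
    by_contra! hcon
    have := Finset.card_le_card_of_injOn τ.symm (s := Finset.Iic i) (t := Finset.Iio i)
      (fun j hj => by simpa using hcon j (by simpa using hj)) τ.symm.injective.injOn
    rw [Fin.card_Iic, Fin.card_Iio] at this
    omega
  have h₁ := hτ hij
  simp only [Equiv.apply_symm_apply] at h₁
  refine (pow_le_pow_left₀ (norm_nonneg _) h₁ 2).trans (h j ?_)
  have : (j : ℕ) ≤ i := hj
  omega

/-- If the coefficient vector of a problem satisfies no short relation modulo `N`, then all short
vectors of the `N`-orthogonal lattice are orthogonal to the hidden lattice. -/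
theorem mem_orth_of_short {n m N : ℕ} (hn : 0 < n) {μ c : ℝ} (hμ : 0 ≤ μ) (hc : 0 ≤ c)
    {B : Fin n → Fin m → ℤ} (hB : size B ≤ μ) {a : Fin n → ZMod N}
    (ha : a ∉ relatedVectors n N (relationRadius n m c μ)) {u : Fin m → ℤ}
    (hu : u ∈ orthMod (publicLattice (F N B a)))
    (hnorm : ‖toEuclidean u‖ ^ 2 ≤ c ^ (m - 1) * (μ ^ n) ^ 2) :
    u ∈ orth (hiddenLattice B) := by
  rw [mem_orth_hiddenLattice]
  by_contra! hcon
  obtain ⟨i₀, hi₀⟩ := hcon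
  -- The inner products form a nonzero relation; Cauchy–Schwarz with `‖v_i‖ ≤ √n μ` bounds its
  -- entries by `relationRadius`.
  refine ha ⟨fun i => u ⬝ᵥ B i, fun h => hi₀ (congrFun h i₀), fun i => ?_, ?_⟩
  · have h₁ : ‖toEuclidean u‖ ≤ Real.sqrt (c ^ (m - 1)) * μ ^ n := by
      rw [← sq_le_sq₀ (norm_nonneg _) (by positivity), mul_pow, Real.sq_sqrt (by positivity)]
      exact hnorm
    have h₂ : ‖toEuclidean (B i)‖ ≤ Real.sqrt n * μ := by
      rw [← sq_le_sq₀ (norm_nonneg _) (by positivity), mul_pow, Real.sq_sqrt (by positivity)]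
      exact (Finset.single_le_sum (f := fun i => ‖toEuclidean (B i)‖ ^ 2)
        (fun _ _ => sq_nonneg _) (Finset.mem_univ i)).trans (sum_norm_sq_le hn hμ hB)
    rw [← inner_toEuclidean]
    refine (abs_real_inner_le_norm _ _).trans
      ((mul_le_mul h₁ h₂ (norm_nonneg _) (by positivity)).trans_eq ?_)
    rw [relationRadius]
    ring
  · rw [← sum_mul_F]
    exact mem_orthMod_publicLattice.1 hu

theorem orth_le_orthMod {n m N : ℕ} (B : Fin n → Fin m → ℤ) (a : Fin n → ZMod N) :
    orth (hiddenLattice B) ≤ orthMod (publicLattice (F N B a)) := by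
  intro u hu
  rw [mem_orthMod_publicLattice, sum_mul_F]
  exact Finset.sum_eq_zero fun i _ => by
    rw [mem_orth_hiddenLattice.1 hu i, Int.cast_zero, mul_zero]

theorem firstVectorsOrthogonal_F {n m N : ℕ} (hn : 0 < n) {μ δ : ℝ} (hμ : 0 ≤ μ)
    (hδ : 1 / 4 < δ) (hδ1 : δ ≤ 1) {B : Fin n → Fin m → ℤ} (hBi : LinearIndependent ℤ B)
    (hB : size B ≤ μ) {a : Fin n → ZMod N}
    (ha : a ∉ relatedVectors n N (relationRadius n m (δ - 1 / 4)⁻¹ μ)) :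
    FirstVectorsOrthogonal δ B (F N B a) := by
  intro u hu
  obtain ⟨ι, _, t, hcard, ht, hshort⟩ := exists_short_vectors_orth hBi
  have hbound : ∀ j : Fin m, (j : ℕ) < m - n →
      ‖toEuclidean (u j)‖ ^ 2 ≤ (δ - 1 / 4)⁻¹ ^ (m - 1) * (μ ^ n) ^ 2 := by
    intro j hj
    refine hu.norm_le hδ hδ1 ht (fun l => orth_le_orthMod B a (hshort l).1) (fun l => ?_) j
      (hcard ▸ hj)
    exact pow_le_pow_left₀ (norm_nonneg _) ((hshort l).2.trans (prod_norm_le hn hμ hB)) 2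
  have hmem : ∀ j, u j ∈ orthMod (publicLattice (F N B a)) := fun j =>
    hu.isBasis.2 ▸ subset_span ⟨j, rfl⟩
  have hc : 0 ≤ (δ - 1 / 4)⁻¹ := inv_nonneg.2 (by linarith)
  exact fun i hi => ⟨mem_orth_of_short hn hμ hc hB ha (hmem i) (hbound i hi), fun τ hτ =>
    mem_orth_of_short hn hμ hc hB ha (hmem _) (hτ.norm_le hbound i hi)⟩

theorem orth_spanFirst_eq_completion {n m : ℕ} (hnm : n ≤ m) {B : Fin n → Fin m → ℤ}
    (hB : LinearIndependent ℤ B) {v : Fin m → Fin m → ℤ} (hv : LinearIndependent ℤ v)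
    (hvB : ∀ i : Fin m, (i : ℕ) < m - n → v i ∈ orth (hiddenLattice B)) :
    orth (spanFirst n v) = completion (hiddenLattice B) := by
  let s : {i : Fin m // (i : ℕ) < m - n} → Fin m → ℤ := fun i => v i
  have hspan : spanFirst n v = span ℤ (Set.range s) := by
    rw [spanFirst, Set.image_eq_range]
    rfl
  rw [hspan]
  refine orth_span_eq_completion hB (hv.comp _ Subtype.val_injective) ?_ fun l => hvB l.1 l.2
  have : Fintype.card {i : Fin m // (i : ℕ) < m - n} = m - n := by
    rw [Fintype.card_subtype, Fin.card_filter_val_lt]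
    omega
  omega

/-- For every reduced basis and every sorting, the lattice whose basis is returned is the
completion. Success also requires that an output exist, hence the reduced basis, the sorting and the
basis of the completion constructed here. -/
theorem mem_solvedI_of_firstVectorsOrthogonal {n m N : ℕ} (hnm : n ≤ m) (hN : 0 < N) {δ : ℝ}
    (hδ1 : δ ≤ 1) {B : Fin n → Fin m → ℤ} (hB : LinearIndependent ℤ B) {x : Fin m → ZMod N}
    (hx : x ∈ problems N B) (h : FirstVectorsOrthogonal δ B x) : x ∈ solvedI N δ B := by
  have key : ∀ (u : Fin m → Fin m → ℤ) (τ : Equiv.Perm (Fin m)),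
      IsLLLReducedBasis δ (orthMod (publicLattice x)) u → OrdersByNorm u τ →
        orth (spanFirst n fun i => u (τ i)) = completion (hiddenLattice B) := fun u τ hu hτ =>
    orth_spanFirst_eq_completion hnm hB (hu.isBasis.1.comp τ τ.injective)
      fun i hi => (h u hu i hi).2 τ hτ
  refine ⟨hx, ?_, ?_⟩
  · obtain ⟨b, hb⟩ := exists_isLatticeBasis_orthMod hN x
    obtain ⟨u, hu⟩ := exists_isLLLReducedBasis hb hδ1
    obtain ⟨w, hw⟩ := exists_isLatticeBasis_completion hB
    have hτ : OrdersByNorm u (Tuple.sort fun i => ‖toEuclidean (u i)‖) :=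
      Tuple.monotone_sort fun i => ‖toEuclidean (u i)‖
    exact ⟨w, u, _, hu, hτ, (key u _ hu hτ).symm ▸ hw⟩
  · rintro w ⟨u, τ, hu, hτ, hw⟩
    exact key u τ hu hτ ▸ hw

end HiddenLattice

/-! ### The main theorem -/

open HiddenLattice in
theorem theorem1 (n m N : ℕ) (hn : 3 ≤ n) (hnm : n < m) (hN : 0 < N)
    (μ : ℝ) (hμ : 1 ≤ μ)
    (δ : ℝ) (hδ : 1 / 4 < δ) (hδ1 : δ < 1)
    (c : ℝ) (hc : c = (δ - 1 / 4)⁻¹)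
    (ε : ℝ) (hε : 0 < ε) (hε1 : ε < 1)
    (hlog : Real.log ((N : ℝ) * ε) >
      (m : ℝ) * n / 2 * Real.log c + (n : ℝ) * (n + 1) * Real.log μ
        + (n : ℝ) * ((m : ℝ) - n) / 2 * Real.log (2 / 3 * ((m : ℝ) - n))
        + (n : ℝ) * Real.log (3 * Real.sqrt n) + 1)
    (B : Fin n → Fin m → ℤ) (hB : B ∈ HiddenLattice.Omega n m N μ) :
    (HiddenLattice.problems N B).ncard = N ^ n ∧
    ((HiddenLattice.solvedI N δ B).ncard : ℝ) / ((HiddenLattice.problems N B).ncard : ℝ)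
      ≥ 1 - ε ∧
    ({x ∈ HiddenLattice.solvedI N δ B |
        HiddenLattice.FirstVectorsOrthogonal δ B x}.ncard : ℝ) ≥ (1 - ε) * (N : ℝ) ^ n := by
  have : NeZero N := ⟨hN.ne'⟩
  have hN0 : (0 : ℝ) < N := by exact_mod_cast hN
  have hc43 : 4 / 3 ≤ c := by
    rw [hc, le_inv_comm₀ (by norm_num) (by linarith)]
    linarith
  set R := relationRadius n m c μ with hR
  have hR1 : 3 / 2 ≤ R := by
    have h₁ : 3 / 2 ≤ Real.sqrt n := by
      refine Real.le_sqrt_of_sq_le ?_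
      have : (3 : ℝ) ≤ n := by exact_mod_cast hn
      linarith
    have h₂ : 1 ≤ Real.sqrt (c ^ (m - 1)) :=
      Real.one_le_sqrt.2 (one_le_pow₀ (by linarith))
    have h₃ : 1 ≤ μ ^ (n + 1) := one_le_pow₀ hμ
    rw [hR, relationRadius]
    calc (3 / 2 : ℝ) = 3 / 2 * 1 * 1 := by norm_num
      _ ≤ _ := by gcongr
  have hexp := exp_mul_relationRadius_lt hn hnm hN hμ hc43 hε hlog
  -- Since `√8 R ≥ 1`, the bound `hexp` gives `e < N ε < N`.
  have hN1 : 1 < N := by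
    have h₁ : 1 ≤ (Real.sqrt 8 * R) ^ n := by
      refine one_le_pow₀ ?_
      have : 1 ≤ Real.sqrt 8 := Real.one_le_sqrt.2 (by norm_num)
      nlinarith
    have h₂ := Real.exp_one_gt_d9
    have h₃ : (1 : ℝ) < N := by nlinarith
    exact_mod_cast h₃
  have hBi := linearIndependent_of_reduce hN1 hB.1
  have hinj := F_injective hB.1
  have hcardT : Nat.card (Fin n → ZMod N) = N ^ n := by simp
  have hprob : (problems N B).ncard = N ^ n := by
    rw [problems, ← Set.image_univ, Set.ncard_image_of_injective _ hinj, Set.ncard_univ, hcardT]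
  have hrel : ((relatedVectors n N R).ncard : ℝ) ≤ ε * (N : ℝ) ^ n := by
    have h₁ := card_relatedVectors_mul_le (n := n) (N := N) (R := R) (by linarith)
    have h₂ := (sum_mul_pow_le hn hR1).trans hexp.le
    have h₃ : (0 : ℝ) ≤ (N : ℝ) ^ n := by positivity
    have h₄ := h₁.trans (mul_le_mul_of_nonneg_left h₂ h₃)
    refine le_of_mul_le_mul_right (h₄.trans_eq ?_) hN0
    ring
  have hgood : (1 - ε) * (N : ℝ) ^ n ≤ ((F N B '' (relatedVectors n N R)ᶜ).ncard : ℝ) := by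
    rw [Set.ncard_image_of_injective _ hinj]
    have h₁ := Set.ncard_add_ncard_compl (relatedVectors n N R)
    rw [hcardT] at h₁
    have h₂ : ((relatedVectors n N R).ncard : ℝ) + ((relatedVectors n N R)ᶜ.ncard : ℝ) =
        (N : ℝ) ^ n := by exact_mod_cast h₁
    linarith
  -- Every coefficient vector without a small relation gives a solved problem, and `F N B` is
  -- injective, so counting coefficient vectors counts problems.
  have hsub : F N B '' (relatedVectors n N R)ᶜ ⊆
      {x ∈ solvedI N δ B | FirstVectorsOrthogonal δ B x} := by
    rintro _ ⟨a, ha, rfl⟩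
    have h₁ : FirstVectorsOrthogonal δ B (F N B a) :=
      firstVectorsOrthogonal_F (by omega) (by linarith) hδ hδ1.le hBi hB.2 (hc ▸ ha)
    exact ⟨mem_solvedI_of_firstVectorsOrthogonal hnm.le hN hδ1.le hBi ⟨a, rfl⟩ h₁, h₁⟩
  have hmain : (1 - ε) * (N : ℝ) ^ n ≤
      ({x ∈ solvedI N δ B | FirstVectorsOrthogonal δ B x}.ncard : ℝ) :=
    hgood.trans (by exact_mod_cast Set.ncard_le_ncard hsub (Set.toFinite _))
  refine ⟨hprob, ?_, hmain⟩
  rw [hprob, ge_iff_le, Nat.cast_pow, le_div_iff₀ (by positivity)]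
  exact hmain.trans (by exact_mod_cast Set.ncard_le_ncard (Set.sep_subset _ _) (Set.toFinite _))
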